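/- Let $M$ be a (Hausdorff) smooth $n$-dimensional manifold without boundary, let $T>0$ and $\alpha\in\mathbb{R}$, and let $(g(t))_{t\in[0,T]}$ be a family of Riemannian metrics on $M$, of class $C^3$ on $[0,T]\times M$ (for instance a smooth family), which solves the Ricci flow equation $$\partial_t g(t)=\alpha\,\mathrm{Ric}_{g(t)},\qquad t\in[0,T].$$ For a diffusion with generator $L_t=\tfrac12\Delta_{g(t)}+Z(t,\cdot)$, where $Z(t,\cdot)$ is a time-dependent vector field, the Onsager–Machlup Lagrangian is, for $x\in M$ and $v\in T_xM$, $$H(t,x,v)=\tfrac12\|Z(t,x)-v\|_{g(t)}^2+\tfrac12\,\mathrm{div}_{g(t)}Z(t,x)-\tfrac1{12}R_{g(t)}(x)+\tfrac14\,\mathrm{tr}_{g(t)}\big(\partial_t g(t)\big)(x),$$ where $R_{g(t)}$ is the scalar curvature. Consider $L_t=\tfrac12\Delta_{g(t)}$, i.e. $Z=0$, and put $$E(\varphi)=\int_0^T H(t,\varphi(t),\dot\varphi(t))\,dt .$$ A smooth curve $\varphi:[0,T]\to M$ is called critical for $E$ (with fixed end points) if, for every $\varepsilon>0$ and every smooth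 map $\Phi:(-\varepsilon,\varepsilon)\times[0,T]\to M$ with $\Phi(0,\cdot)=\varphi$, $\Phi(s,0)=\varphi(0)$ and $\Phi(s,T)=\varphi(T)$ for all $s$, the function $s\mapsto E(\Phi(s,\cdot))$ is differentiable at $s=0$ with derivative $0$. Then a smooth curve $\varphi:[0,T]\to M$ is critical for $E$ if and only if, for all $t\in[0,T]$, $$\nabla^{t}_{\partial_t}\dot\varphi(t)+\alpha\,\mathrm{Ric}^{\#g(t)}(\dot\varphi(t))+\frac{1-3\alpha}{12}\,\nabla^{t}R_{g(t)}(\varphi(t))=0 .$$ Here $\nabla^t_{\partial_t}$ is the covariant derivative along $\varphi$ for the Levi-Civita connection of $g(t)$, $\nabla^tR_{g(t)}$ is the $g(t)$-gradient of $R_{g(t)}$, $\langle \mathrm{Ric}^{\#g(t)}(v),w\rangle_{g(t)}=\mathrm{Ric}_{g(t)}(v,w)$, and derivatives in $t$ at $0$ and $T$ are one-sided. -/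

import Mathlib

open Set
open scoped Manifold ContDiff

noncomputable section

namespace OnsagerMachlup

/-! ### Riemannian geometry of a metric given in coordinates

Here `E` is the coordinate space and `G y` is the matrix of the metric at the coordinate point `y`,
seen as a bilinear form on `E`. -/

section Coordinates

variable {E : Type*} [NormedAddCommGroup E] [NormedSpace ℝ E]

/-- The linear form `z ↦ K(u, v, z)`, where
`K(u, v, z) = (∂_u G(v, z) + ∂_v G(u, z) - ∂_z G(u, v)) / 2` are the Christoffel symbols of the
first kind. -/
def christoffelFirst (G : E → E →L[ℝ] E →L[ℝ] ℝ) (y u v : E) : E →L[ℝ] ℝ :=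
  (1 / 2 : ℝ) • (fderiv ℝ G y u v + fderiv ℝ G y v u -
    (ContinuousLinearMap.apply ℝ ℝ v ∘L ContinuousLinearMap.apply ℝ (E →L[ℝ] ℝ) u) ∘L
      fderiv ℝ G y)

theorem christoffelFirst_apply (G : E → E →L[ℝ] E →L[ℝ] ℝ) (y u v z : E) :
    christoffelFirst G y u v z =
      (1 / 2 : ℝ) * (fderiv ℝ G y u v z + fderiv ℝ G y v u z - fderiv ℝ G y z u v) := rfl

variable [FiniteDimensional ℝ E]

/-- A bilinear map on a finite-dimensional space is continuous. -/
def toBilinCLM {F : Type*} [NormedAddCommGroup F] [NormedSpace ℝ F] (B : E →ₗ[ℝ] E →ₗ[ℝ] F) :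
    E →L[ℝ] E →L[ℝ] F :=
  LinearMap.toContinuousLinearMap
    ((LinearMap.toContinuousLinearMap : (E →ₗ[ℝ] F) ≃ₗ[ℝ] (E →L[ℝ] F)).toLinearMap ∘ₗ B)

theorem toBilinCLM_apply {F : Type*} [NormedAddCommGroup F] [NormedSpace ℝ F]
    (B : E →ₗ[ℝ] E →ₗ[ℝ] F) (u v : E) : toBilinCLM B u v = B u v := rfl

/-- The Christoffel symbols of the Levi-Civita connection, as a bilinear map: `Γ(u, v)` is the
vector with `G(Γ(u, v), z) = K(u, v, z)` for all `z`, i.e. `Γ(∂_i, ∂_j) = Γ^k_{ij} ∂_k`. -/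
def christoffel (G : E → E →L[ℝ] E →L[ℝ] ℝ) (y : E) : E →L[ℝ] E →L[ℝ] E :=
  toBilinCLM (LinearMap.mk₂ ℝ
    (fun u v => ContinuousLinearMap.inverse (G y) (christoffelFirst G y u v))
    (fun u u' v => by
      rw [← map_add]; congr 1; ext z
      simp only [christoffelFirst_apply, map_add, add_apply]; ring)
    (fun c u v => by
      rw [← map_smul]; congr 1; ext z
      simp only [christoffelFirst_apply, map_smul, smul_apply, smul_eq_mul]
      ring)
    (fun u v v' => by
      rw [← map_add]; congr 1; ext z
      simp only [christoffelFirst_apply, map_add, add_apply]; ring)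
    (fun c u v => by
      rw [← map_smul]; congr 1; ext z
      simp only [christoffelFirst_apply, map_smul, smul_apply, smul_eq_mul]
      ring))

theorem christoffel_apply (G : E → E →L[ℝ] E →L[ℝ] ℝ) (y u v : E) :
    christoffel G y u v = ContinuousLinearMap.inverse (G y) (christoffelFirst G y u v) := rfl

/-- The endomorphism `u ↦ R(u, v) w` of the curvature tensor
`R(u, v) w = ∂_u Γ(v, w) - ∂_v Γ(u, w) + Γ(u, Γ(v, w)) - Γ(v, Γ(u, w))`. -/
def curvatureEnd (G : E → E →L[ℝ] E →L[ℝ] ℝ) (y v w : E) : E →L[ℝ] E :=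
  (ContinuousLinearMap.apply ℝ E w ∘L ContinuousLinearMap.apply ℝ (E →L[ℝ] E) v) ∘L
      fderiv ℝ (christoffel G) y
    - (fderiv ℝ (christoffel G) y v).flip w
    + (christoffel G y).flip (christoffel G y v w)
    - (christoffel G y v) ∘L ((christoffel G y).flip w)

theorem curvatureEnd_apply (G : E → E →L[ℝ] E →L[ℝ] ℝ) (y v w u : E) :
    curvatureEnd G y v w u =
      fderiv ℝ (christoffel G) y u v w - fderiv ℝ (christoffel G) y v u w
        + christoffel G y u (christoffel G y v w) - christoffel G y v (christoffel G y u w) := rfl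

/-- The Ricci tensor in coordinates, `Ric(v, w) = tr (u ↦ R(u, v) w)`. -/
def coordRicci (G : E → E →L[ℝ] E →L[ℝ] ℝ) (y : E) : E →L[ℝ] E →L[ℝ] ℝ :=
  toBilinCLM (LinearMap.mk₂ ℝ
    (fun v w => LinearMap.trace ℝ E (curvatureEnd G y v w).toLinearMap)
    (fun v v' w => by
      rw [← map_add]; congr 1; ext u
      simp only [LinearMap.add_apply, ContinuousLinearMap.coe_coe, curvatureEnd_apply, map_add,
        add_apply]
      abel)
    (fun c v w => by
      rw [← map_smul]; congr 1; ext u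
      simp only [LinearMap.smul_apply, ContinuousLinearMap.coe_coe, curvatureEnd_apply, map_smul,
        smul_apply, smul_sub, smul_add])
    (fun v w w' => by
      rw [← map_add]; congr 1; ext u
      simp only [LinearMap.add_apply, ContinuousLinearMap.coe_coe, curvatureEnd_apply, map_add]
      abel)
    (fun c v w => by
      rw [← map_smul]; congr 1; ext u
      simp only [LinearMap.smul_apply, ContinuousLinearMap.coe_coe, curvatureEnd_apply, map_smul,
        smul_sub, smul_add]))

theorem coordRicci_apply (G : E → E →L[ℝ] E →L[ℝ] ℝ) (y v w : E) :
    coordRicci G y v w = LinearMap.trace ℝ E (curvatureEnd G y v w).toLinearMap := rfl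

end Coordinates

/-! ### Riemannian geometry on a manifold -/

section Manifold

variable {n : ℕ} {M : Type*} [TopologicalSpace M] [ChartedSpace (EuclideanSpace ℝ (Fin n)) M]

/-- The differential at `x` of the chart centred at `p`. -/
def dChart (p x : M) : TangentSpace (𝓡 n) x →L[ℝ] EuclideanSpace ℝ (Fin n) :=
  mfderiv (𝓡 n) 𝓘(ℝ, EuclideanSpace ℝ (Fin n)) (extChartAt (𝓡 n) p) x

/-- The differential at the coordinate point `y` of the inverse of the chart centred at `p`. -/
def dChartSymm (p : M) (y : EuclideanSpace ℝ (Fin n)) :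
    EuclideanSpace ℝ (Fin n) →L[ℝ] TangentSpace (𝓡 n) ((extChartAt (𝓡 n) p).symm y) :=
  mfderiv 𝓘(ℝ, EuclideanSpace ℝ (Fin n)) (𝓡 n) (extChartAt (𝓡 n) p).symm y

/-- Pull-back of a bilinear form along a linear map. -/
def pullForm {V W : Type*} [AddCommGroup V] [Module ℝ V] [TopologicalSpace V]
    [IsTopologicalAddGroup V] [ContinuousSMul ℝ V]
    [AddCommGroup W] [Module ℝ W] [TopologicalSpace W]
    [IsTopologicalAddGroup W] [ContinuousSMul ℝ W]
    (A : W →L[ℝ] W →L[ℝ] ℝ) (L : V →L[ℝ] W) : V →L[ℝ] V →L[ℝ] ℝ :=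
  ((ContinuousLinearMap.precomp ℝ L) ∘L A) ∘L L

theorem pullForm_apply {V W : Type*} [AddCommGroup V] [Module ℝ V] [TopologicalSpace V]
    [IsTopologicalAddGroup V] [ContinuousSMul ℝ V]
    [AddCommGroup W] [Module ℝ W] [TopologicalSpace W]
    [IsTopologicalAddGroup W] [ContinuousSMul ℝ W]
    (A : W →L[ℝ] W →L[ℝ] ℝ) (L : V →L[ℝ] W) (v w : V) :
    pullForm A L v w = A (L v) (L w) := rfl

/-- The coefficients of the metric `g` in the chart centred at `p`. -/
def chartMetric (g : Bundle.RiemannianMetric (fun x : M => TangentSpace (𝓡 n) x)) (p : M)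
    (y : EuclideanSpace ℝ (Fin n)) :
    EuclideanSpace ℝ (Fin n) →L[ℝ] EuclideanSpace ℝ (Fin n) →L[ℝ] ℝ :=
  pullForm (g.inner ((extChartAt (𝓡 n) p).symm y)) (dChartSymm p y)

/-- The Ricci tensor of `g` at `x`. -/
def ricci (g : Bundle.RiemannianMetric (fun x : M => TangentSpace (𝓡 n) x)) (x : M) :
    TangentSpace (𝓡 n) x →L[ℝ] TangentSpace (𝓡 n) x →L[ℝ] ℝ :=
  pullForm (coordRicci (chartMetric g x) (extChartAt (𝓡 n) x x)) (dChart x x)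

/-- For a bilinear form `A` on `T_x M`, the endomorphism `A^♯` with
`⟨A^♯ v, w⟩_g = A(v, w)`. -/
def sharp (g : Bundle.RiemannianMetric (fun x : M => TangentSpace (𝓡 n) x)) (x : M)
    (A : TangentSpace (𝓡 n) x →L[ℝ] TangentSpace (𝓡 n) x →L[ℝ] ℝ) :
    TangentSpace (𝓡 n) x →L[ℝ] TangentSpace (𝓡 n) x :=
  (ContinuousLinearMap.inverse (g.inner x)) ∘L A

/-- The trace of a bilinear form with respect to `g`. -/
def metricTrace (g : Bundle.RiemannianMetric (fun x : M => TangentSpace (𝓡 n) x)) (x : M)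
    (A : TangentSpace (𝓡 n) x →L[ℝ] TangentSpace (𝓡 n) x →L[ℝ] ℝ) : ℝ :=
  LinearMap.trace ℝ (TangentSpace (𝓡 n) x) (sharp g x A).toLinearMap

/-- The scalar curvature of `g`. -/
def scalarCurvature (g : Bundle.RiemannianMetric (fun x : M => TangentSpace (𝓡 n) x)) (x : M) : ℝ :=
  metricTrace g x (ricci g x)

/-- The gradient of `f` with respect to `g`: `⟨∇f, w⟩_g = df(w)`. -/
def gradient (g : Bundle.RiemannianMetric (fun x : M => TangentSpace (𝓡 n) x)) (f : M → ℝ) (x : M) :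
    TangentSpace (𝓡 n) x :=
  ContinuousLinearMap.inverse (g.inner x) (mfderiv (𝓡 n) 𝓘(ℝ, ℝ) f x)

/-- The divergence of a vector field, `div_g Z = tr (v ↦ ∇_v Z)`, computed at `x` in the chart
centred at `x`. -/
def divergence (g : Bundle.RiemannianMetric (fun x : M => TangentSpace (𝓡 n) x))
    (Z : ∀ x : M, TangentSpace (𝓡 n) x) (x : M) : ℝ :=
  let y₀ : EuclideanSpace ℝ (Fin n) := extChartAt (𝓡 n) x x
  let Zc : EuclideanSpace ℝ (Fin n) → EuclideanSpace ℝ (Fin n) := fun y =>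
    dChart x ((extChartAt (𝓡 n) x).symm y) (Z ((extChartAt (𝓡 n) x).symm y))
  LinearMap.trace ℝ (EuclideanSpace ℝ (Fin n))
    (fderiv ℝ Zc y₀ + (christoffel (chartMetric g x) y₀).flip (Zc y₀)).toLinearMap

/-- The velocity of a curve parametrised by `J` (one-sided at the end points of an interval). -/
def velocity (J : Set ℝ) (φ : ℝ → M) (t : ℝ) : TangentSpace (𝓡 n) (φ t) :=
  mfderivWithin 𝓘(ℝ, ℝ) (𝓡 n) φ J t (1 : ℝ)

/-- The covariant derivative `∇_{∂_t} V` at time `t` of a vector field `V` along the curve `φ`, for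
the Levi-Civita connection of `g`: in the chart centred at `φ t` its components are
`(V^k)' + Γ^k_{ij} (φ^i)' V^j`. -/
def covDerivAlong (g : Bundle.RiemannianMetric (fun x : M => TangentSpace (𝓡 n) x))
    (J : Set ℝ) (φ : ℝ → M) (V : ∀ t : ℝ, TangentSpace (𝓡 n) (φ t)) (t : ℝ) :
    TangentSpace (𝓡 n) (φ t) :=
  ContinuousLinearMap.inverse (dChart (φ t) (φ t))
    (derivWithin (fun s : ℝ => dChart (φ t) (φ s) (V s)) J t
      + christoffel (chartMetric g (φ t)) (extChartAt (𝓡 n) (φ t) (φ t))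
          (dChart (φ t) (φ t) (velocity J φ t)) (dChart (φ t) (φ t) (V t)))

/-! ### Families of metrics and the Onsager-Machlup functional -/

/-- The family `g(t)`, `t ∈ J`, of metrics is of class `C^k` on `J × M`. -/
def IsMetricFamilyOfClass (k : ℕ∞ω) (J : Set ℝ)
    (g : ℝ → Bundle.RiemannianMetric (fun x : M => TangentSpace (𝓡 n) x))
    [IsManifold (𝓡 n) 1 M] : Prop :=
  ContMDiffOn (𝓘(ℝ, ℝ).prod (𝓡 n))
    ((𝓡 n).prod 𝓘(ℝ, EuclideanSpace ℝ (Fin n) →L[ℝ] EuclideanSpace ℝ (Fin n) →L[ℝ] ℝ)) k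
    (fun q : ℝ × M =>
      Bundle.TotalSpace.mk' (EuclideanSpace ℝ (Fin n) →L[ℝ] EuclideanSpace ℝ (Fin n) →L[ℝ] ℝ)
        (E := fun x : M => TangentSpace (𝓡 n) x →L[ℝ] TangentSpace (𝓡 n) x →L[ℝ] ℝ)
        q.2 ((g q.1).inner q.2))
    (J ×ˢ univ)

/-- The family `g(t)` solves `∂_t g(t) = α Ric_{g(t)}` for `t ∈ J`. -/
def IsRicciFlow (α : ℝ) (J : Set ℝ)
    (g : ℝ → Bundle.RiemannianMetric (fun x : M => TangentSpace (𝓡 n) x)) : Prop :=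
  ∀ t ∈ J, ∀ x : M, ∀ v w : TangentSpace (𝓡 n) x,
    HasDerivWithinAt (fun s : ℝ => (g s).inner x v w) (α * ricci (g t) x v w) J t

/-- The time derivative `∂_t g(t)` at `x`, a bilinear form on `T_x M`. -/
def metricDot (J : Set ℝ) (g : ℝ → Bundle.RiemannianMetric (fun x : M => TangentSpace (𝓡 n) x))
    (t : ℝ) (x : M) : TangentSpace (𝓡 n) x →L[ℝ] TangentSpace (𝓡 n) x →L[ℝ] ℝ :=
  derivWithin (F := EuclideanSpace ℝ (Fin n) →L[ℝ] EuclideanSpace ℝ (Fin n) →L[ℝ] ℝ)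
    (fun s : ℝ => (g s).inner x) J t

/-- The Onsager-Machlup Lagrangian of the diffusion with generator `L_t = ½ Δ_{g(t)} + Z(t, ·)`:
`H(t, x, v) = ½ |Z(t, x) - v|² + ½ div Z(t, x) - R(x) / 12 + tr (∂_t g(t)) / 4`, all with respect
to `g(t)`. -/
def lagrangian (J : Set ℝ) (g : ℝ → Bundle.RiemannianMetric (fun x : M => TangentSpace (𝓡 n) x))
    (Z : ℝ → ∀ x : M, TangentSpace (𝓡 n) x) (t : ℝ) (x : M) (v : TangentSpace (𝓡 n) x) : ℝ :=
  1 / 2 * (g t).inner x (Z t x - v) (Z t x - v) + 1 / 2 * divergence (g t) (Z t) x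
    - 1 / 12 * scalarCurvature (g t) x + 1 / 4 * metricTrace (g t) x (metricDot J g t x)

/-- The functional `E(φ) = ∫₀ᵀ H(t, φ(t), φ'(t)) dt`. -/
def energy (T : ℝ) (g : ℝ → Bundle.RiemannianMetric (fun x : M => TangentSpace (𝓡 n) x))
    (Z : ℝ → ∀ x : M, TangentSpace (𝓡 n) x) (φ : ℝ → M) : ℝ :=
  ∫ t in (0 : ℝ)..T, lagrangian (Icc 0 T) g Z t (φ t) (velocity (Icc 0 T) φ t)

/-- `φ : [0, T] → M` is critical for `F` among curves with the same end points: for each smooth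
variation `Φ(s, t)` of `φ = Φ(0, ·)` with fixed end points, `s ↦ F(Φ(s, ·))` has derivative `0` at
`s = 0`. -/
def IsCriticalCurve (n : ℕ) {M : Type*} [TopologicalSpace M]
    [ChartedSpace (EuclideanSpace ℝ (Fin n)) M] (T : ℝ) (F : (ℝ → M) → ℝ) (φ : ℝ → M) : Prop :=
  ∀ (Φ : ℝ → ℝ → M) (ε : ℝ), 0 < ε →
    ContMDiffOn 𝓘(ℝ, ℝ × ℝ) (𝓡 n) ∞ (fun q : ℝ × ℝ => Φ q.1 q.2) (Ioo (-ε) ε ×ˢ Icc 0 T) →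
    (∀ t ∈ Icc 0 T, Φ 0 t = φ t) →
    (∀ s ∈ Ioo (-ε) ε, Φ s 0 = φ 0 ∧ Φ s T = φ T) →
    HasDerivAt (fun s : ℝ => F (Φ s)) 0 0

end Manifold

end OnsagerMachlup

end

/-! With `Z = 0` the divergence term vanishes, and tracing the flow equation gives `tr (∂_t g) = α
R`. The Lagrangian is therefore `½ |v|² - κ R` with `κ = (1 - 3α) / 12`, a mechanical Lagrangian on
a moving metric (`lagrangian_eq`).

For a variation `Φ(s, t)`, compatibility of the connection with the metric and symmetry of mixed
partials give the pointwise identity `∂_t ⟨∂_t Φ, ∂_s Φ⟩ - ∂_s H = (∂_t g)(∂_t Φ, ∂_s Φ) + ⟨∇_t ∂_t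
Φ, ∂_s Φ⟩ + κ dR(∂_s Φ)`. Since `∂_t g = α Ric`, the right side is `⟨EL, ∂_s Φ⟩`, where `EL` is the
left side of the asserted equation. It is computed in coordinates in `coord_first_variation` and
carried to the manifold in `first_variation`. Integration over `[0, T]` makes the derivative of the
energy equal to boundary terms, zero for fixed end points, minus `∫ ⟨EL, ∂_s Φ⟩`
(`hasDerivAt_energy_of_fixed`). So `EL = 0` implies criticality. The converse is the fundamental
lemma of the calculus of variations, tested with variations `χ(t) ξ` supported in one chart
(`eulerLagrangeComponent_eq_zero`).

The curvature at `x` is defined in the chart centred at `x`, so the chart moves with the point. To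
differentiate `R` it must be expressed in one fixed chart, which requires the tensorial behaviour of
the curvature under coordinate changes (`fderiv_apply_curvatureEnd`, `ricci_eq_chart`,
`scalarCurvature_eq_chart`). Class `C^3` of the metric is what makes `R` of class `C^1`. -/

noncomputable section

namespace OnsagerMachlup

/-! ### Regularity of Christoffel symbols and curvature in coordinates -/

section CoordinateCalculus

variable {E : Type*} [NormedAddCommGroup E] [NormedSpace ℝ E]

/-- The spatial derivative of a function on `J × U`. -/
theorem hasFDerivAt_slice {F : Type*} [NormedAddCommGroup F] [NormedSpace ℝ F]
    {f : ℝ → E → F} {J : Set ℝ} {U : Set E} (hU : IsOpen U)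
    (hf : DifferentiableOn ℝ (Function.uncurry f) (J ×ˢ U)) {t : ℝ} (ht : t ∈ J) {y : E}
    (hy : y ∈ U) :
    HasFDerivAt (f t)
      ((fderivWithin ℝ (Function.uncurry f) (J ×ˢ U) (t, y)).comp (ContinuousLinearMap.inr ℝ ℝ E))
      y := by
  have h1 := (hf (t, y) ⟨ht, hy⟩).hasFDerivWithinAt
  have h2 : HasFDerivWithinAt (fun z : E => (t, z)) (ContinuousLinearMap.inr ℝ ℝ E) U y :=
    (hasFDerivAt_prodMk_right t y).hasFDerivWithinAt
  exact (h1.comp y h2 (fun z hz => ⟨ht, hz⟩)).hasFDerivAt (hU.mem_nhds hy)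

/-- The spatial derivative of a function on `J × U` of class `C^k` is of class `C^m`, `m + 1 ≤ k`. -/
theorem contDiffOn_fderiv_slice {F : Type*} [NormedAddCommGroup F] [NormedSpace ℝ F]
    {f : ℝ → E → F} {J : Set ℝ} {U : Set E} (hJ : UniqueDiffOn ℝ J) (hU : IsOpen U) {m k : ℕ∞ω}
    (hmk : m + 1 ≤ k) (hf : ContDiffOn ℝ k (Function.uncurry f) (J ×ˢ U)) :
    ContDiffOn ℝ m (fun q : ℝ × E => fderiv ℝ (f q.1) q.2) (J ×ˢ U) := by
  have h1 : ContDiffOn ℝ m (fderivWithin ℝ (Function.uncurry f) (J ×ˢ U)) (J ×ˢ U) :=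
    hf.fderivWithin (hJ.prod hU.uniqueDiffOn) hmk
  have h2 : ContDiffOn ℝ m (fun q => (fderivWithin ℝ (Function.uncurry f) (J ×ˢ U) q).comp
      (ContinuousLinearMap.inr ℝ ℝ E)) (J ×ˢ U) := h1.clm_comp contDiffOn_const
  refine h2.congr fun q hq => ?_
  have hd : DifferentiableOn ℝ (Function.uncurry f) (J ×ˢ U) :=
    hf.differentiableOn (by
      intro h; subst h; simp at hmk)
  exact (hasFDerivAt_slice hU hd hq.1 hq.2).fderiv

theorem contDiffOn_slice {F : Type*} [NormedAddCommGroup F] [NormedSpace ℝ F]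
    {f : ℝ → E → F} {J : Set ℝ} {U : Set E} {k : ℕ∞ω}
    (hf : ContDiffOn ℝ k (Function.uncurry f) (J ×ˢ U)) {t : ℝ} (ht : t ∈ J) :
    ContDiffOn ℝ k (f t) U :=
  hf.comp (contDiff_prodMk_right t).contDiffOn (fun _ hz => ⟨ht, hz⟩)

variable [FiniteDimensional ℝ E]

/-- A positive definite bilinear form on a finite-dimensional space is nondegenerate. -/
theorem isInvertible_of_pos {A : E →L[ℝ] E →L[ℝ] ℝ} (hA : ∀ v, v ≠ 0 → 0 < A v v) :
    A.IsInvertible := by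
  have hinj : Function.Injective A.toLinearMap := by
    rw [injective_iff_map_eq_zero]
    intro v hv
    by_contra hne
    have h := hA v hne
    have hv' : A v = 0 := hv
    rw [hv'] at h
    simp at h
  have hfin : Module.finrank ℝ E = Module.finrank ℝ (E →L[ℝ] ℝ) := by
    rw [← (LinearMap.toContinuousLinearMap : (E →ₗ[ℝ] ℝ) ≃ₗ[ℝ] (E →L[ℝ] ℝ)).finrank_eq]
    exact (Subspace.dual_finrank_eq (K := ℝ) (V := E)).symm
  refine ⟨(LinearEquiv.ofInjectiveOfFinrankEq A.toLinearMap hinj hfin).toContinuousLinearEquiv, ?_⟩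
  ext v w
  rfl

theorem apply_christoffel {G : E → E →L[ℝ] E →L[ℝ] ℝ} {y : E} (hG : (G y).IsInvertible)
    (u v z : E) :
    G y (christoffel G y u v) z =
      (1 / 2 : ℝ) * (fderiv ℝ G y u v z + fderiv ℝ G y v u z - fderiv ℝ G y z u v) := by
  rw [christoffel_apply, hG.self_apply_inverse, christoffelFirst_apply]

variable {G : ℝ → E → E →L[ℝ] E →L[ℝ] ℝ} {J : Set ℝ} {U : Set E}

/-- One derivative is lost to `fderiv`; inversion costs nothing, being smooth at invertible maps. In
finite dimension it suffices to check regularity on fixed vectors. -/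
theorem contDiffOn_christoffel (hJ : UniqueDiffOn ℝ J) (hU : IsOpen U) {m k : ℕ∞ω}
    (hmk : m + 1 ≤ k) (hG : ContDiffOn ℝ k (Function.uncurry G) (J ×ˢ U))
    (hinv : ∀ t ∈ J, ∀ y ∈ U, (G t y).IsInvertible) :
    ContDiffOn ℝ m (Function.uncurry fun t => christoffel (G t)) (J ×ˢ U) := by
  have hm : m ≤ k := le_trans le_self_add hmk
  have hd := contDiffOn_fderiv_slice hJ hU hmk hG
  have hi : ContDiffOn ℝ m (fun q : ℝ × E => ContinuousLinearMap.inverse (G q.1 q.2))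
      (J ×ˢ U) := by
    intro q hq
    exact ((hinv q.1 hq.1 q.2 hq.2).contDiffAt_map_inverse).comp_contDiffWithinAt q
      ((hG.of_le hm) q hq)
  rw [contDiffOn_clm_apply]
  intro u
  rw [contDiffOn_clm_apply]
  intro v
  have hK : ContDiffOn ℝ m (fun q : ℝ × E => christoffelFirst (G q.1) q.2 u v) (J ×ˢ U) := by
    rw [contDiffOn_clm_apply]
    intro z
    have h3 : ∀ a b c : E, ContDiffOn ℝ m (fun q : ℝ × E => fderiv ℝ (G q.1) q.2 a b c)
        (J ×ˢ U) := fun a b c =>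
      ((hd.clm_apply contDiffOn_const).clm_apply contDiffOn_const).clm_apply contDiffOn_const
    exact contDiffOn_const.mul (((h3 u v z).add (h3 v u z)).sub (h3 z u v))
  exact hi.clm_apply hK

theorem contDiffOn_coordRicci (hJ : UniqueDiffOn ℝ J) (hU : IsOpen U) {l m k : ℕ∞ω}
    (hlm : l + 1 ≤ m) (hmk : m + 1 ≤ k) (hG : ContDiffOn ℝ k (Function.uncurry G) (J ×ˢ U))
    (hinv : ∀ t ∈ J, ∀ y ∈ U, (G t y).IsInvertible) :
    ContDiffOn ℝ l (fun q : ℝ × E => coordRicci (G q.1) q.2) (J ×ˢ U) := by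
  have hc := contDiffOn_christoffel hJ hU hmk hG hinv
  have hd := contDiffOn_fderiv_slice hJ hU hlm hc
  have hc' : ContDiffOn ℝ l (fun q : ℝ × E => christoffel (G q.1) q.2) (J ×ˢ U) :=
    hc.of_le (le_trans le_self_add hlm)
  rw [contDiffOn_clm_apply]
  intro v
  rw [contDiffOn_clm_apply]
  intro w
  have hR : ContDiffOn ℝ l (fun q : ℝ × E => curvatureEnd (G q.1) q.2 v w) (J ×ˢ U) := by
    rw [contDiffOn_clm_apply]
    intro u
    have h2 : ∀ a : E, ∀ b : ℝ × E → E, ContDiffOn ℝ l b (J ×ˢ U) →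
        ContDiffOn ℝ l (fun q : ℝ × E => christoffel (G q.1) q.2 a (b q)) (J ×ˢ U) :=
      fun a b hb => (hc'.clm_apply contDiffOn_const).clm_apply hb
    have h3 : ∀ a b c : E, ContDiffOn ℝ l
        (fun q : ℝ × E => fderiv ℝ (christoffel (G q.1)) q.2 a b c) (J ×ˢ U) := fun a b c =>
      ((hd.clm_apply contDiffOn_const).clm_apply contDiffOn_const).clm_apply contDiffOn_const
    exact (((h3 u v w).sub (h3 v u w)).add (h2 u _ (h2 v _ contDiffOn_const))).sub
      (h2 v _ (h2 u _ contDiffOn_const))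
  have ht : ContDiff ℝ l (fun A : E →L[ℝ] E => LinearMap.trace ℝ E A.toLinearMap) :=
    (LinearMap.toContinuousLinearMap
      ((LinearMap.trace ℝ E) ∘ₗ (ContinuousLinearMap.coeLM ℝ : (E →L[ℝ] E) →ₗ[ℝ] _))).contDiff
  exact ht.comp_contDiffOn hR

/-- The scalar curvature in coordinates. -/
def coordScalar (G : E → E →L[ℝ] E →L[ℝ] ℝ) (y : E) : ℝ :=
  LinearMap.trace ℝ E (ContinuousLinearMap.inverse (G y) ∘L coordRicci G y).toLinearMap

theorem contDiffOn_coordScalar (hJ : UniqueDiffOn ℝ J) (hU : IsOpen U) {l m k : ℕ∞ω}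
    (hlm : l + 1 ≤ m) (hmk : m + 1 ≤ k) (hG : ContDiffOn ℝ k (Function.uncurry G) (J ×ˢ U))
    (hinv : ∀ t ∈ J, ∀ y ∈ U, (G t y).IsInvertible) :
    ContDiffOn ℝ l (Function.uncurry fun t => coordScalar (G t)) (J ×ˢ U) := by
  have hl : l ≤ k := le_trans le_self_add (le_trans hlm (le_trans le_self_add hmk))
  have hi : ContDiffOn ℝ l (fun q : ℝ × E => ContinuousLinearMap.inverse (G q.1 q.2))
      (J ×ˢ U) := by
    intro q hq
    exact ((hinv q.1 hq.1 q.2 hq.2).contDiffAt_map_inverse).comp_contDiffWithinAt q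
      ((hG.of_le hl) q hq)
  have hR := hi.clm_comp (contDiffOn_coordRicci hJ hU hlm hmk hG hinv)
  have ht : ContDiff ℝ l (fun A : E →L[ℝ] E => LinearMap.trace ℝ E A.toLinearMap) :=
    (LinearMap.toContinuousLinearMap
      ((LinearMap.trace ℝ E) ∘ₗ (ContinuousLinearMap.coeLM ℝ : (E →L[ℝ] E) →ₗ[ℝ] _))).contDiff
  exact ht.comp_contDiffOn hR

end CoordinateCalculus

/-! ### Index raising and traces under pull-back -/

section Pullback

variable {V W : Type*} [AddCommGroup V] [Module ℝ V] [TopologicalSpace V]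
  [IsTopologicalAddGroup V] [ContinuousSMul ℝ V]
  [AddCommGroup W] [Module ℝ W] [TopologicalSpace W]
  [IsTopologicalAddGroup W] [ContinuousSMul ℝ W]

theorem inverse_pullForm_apply {B R : W →L[ℝ] W →L[ℝ] ℝ} {L : V →L[ℝ] W} (hB : B.IsInvertible)
    (hL : L.IsInvertible) (hBL : (pullForm B L).IsInvertible) (v : V) :
    ContinuousLinearMap.inverse (pullForm B L) (pullForm R L v) =
      ContinuousLinearMap.inverse L (ContinuousLinearMap.inverse B (R (L v))) := by
  rw [hBL.inverse_apply_eq]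
  ext w
  rw [pullForm_apply, pullForm_apply, hL.self_apply_inverse, hB.self_apply_inverse]

/-- The two endomorphisms are conjugate by `L`, so the metric trace is coordinate independent. -/
theorem trace_inverse_pullForm {B R : W →L[ℝ] W →L[ℝ] ℝ} {L : V →L[ℝ] W} (hB : B.IsInvertible)
    (hL : L.IsInvertible) (hBL : (pullForm B L).IsInvertible) :
    LinearMap.trace ℝ V (ContinuousLinearMap.inverse (pullForm B L) ∘L pullForm R L).toLinearMap =
      LinearMap.trace ℝ W (ContinuousLinearMap.inverse B ∘L R).toLinearMap := by
  have key : (ContinuousLinearMap.inverse (pullForm B L) ∘L pullForm R L).toLinearMap =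
      (ContinuousLinearMap.inverse L).toLinearMap ∘ₗ
        ((ContinuousLinearMap.inverse B ∘L R).toLinearMap ∘ₗ L.toLinearMap) := by
    ext v
    exact inverse_pullForm_apply hB hL hBL v
  obtain ⟨e, rfl⟩ := hL
  rw [key, ContinuousLinearMap.inverse_equiv]
  exact LinearMap.trace_conj' (ContinuousLinearMap.inverse B ∘L R).toLinearMap
    e.symm.toLinearEquiv

end Pullback

theorem two_le_infty : (2 : ℕ∞ω) ≤ ∞ := by
  exact WithTop.coe_le_coe.2 (le_top : (2 : ℕ∞) ≤ ⊤)

/-! ### Tensoriality of the curvature -/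

section ChangeOfCoordinates

variable {E : Type*} [NormedAddCommGroup E] [NormedSpace ℝ E]
  {G G' : E → E →L[ℝ] E →L[ℝ] ℝ} {ψ : E → E} {O U : Set E}

/-- The first derivatives of a pulled back metric. -/
theorem fderiv_pullForm (hO : IsOpen O) (hU : IsOpen U) (hψ : ContDiffOn ℝ ∞ ψ O)
    (hψU : MapsTo ψ O U) (hG : DifferentiableOn ℝ G O) (hG' : DifferentiableOn ℝ G' U)
    (hGG' : ∀ y ∈ O, G y = pullForm (G' (ψ y)) (fderiv ℝ ψ y)) {y : E} (hy : y ∈ O) (u v z : E) :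
    fderiv ℝ G y u v z =
      fderiv ℝ G' (ψ y) (fderiv ℝ ψ y u) (fderiv ℝ ψ y v) (fderiv ℝ ψ y z)
        + G' (ψ y) (fderiv ℝ (fderiv ℝ ψ) y u v) (fderiv ℝ ψ y z)
        + G' (ψ y) (fderiv ℝ ψ y v) (fderiv ℝ (fderiv ℝ ψ) y u z) := by
  have hψ1 : HasFDerivAt ψ (fderiv ℝ ψ y) y :=
    ((hψ.contDiffAt (hO.mem_nhds hy)).differentiableAt (by simp)).hasFDerivAt
  have hψ2 : HasFDerivAt (fderiv ℝ ψ) (fderiv ℝ (fderiv ℝ ψ) y) y :=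
    (((hψ.contDiffAt (hO.mem_nhds hy)).fderiv_right (m := ∞) (by simp)).differentiableAt
      (by simp)).hasFDerivAt
  have h0 : HasFDerivAt G (fderiv ℝ G y) y :=
    ((hG y hy).differentiableAt (hO.mem_nhds hy)).hasFDerivAt
  have h0' : HasFDerivAt G' (fderiv ℝ G' (ψ y)) (ψ y) :=
    ((hG' _ (hψU hy)).differentiableAt (hU.mem_nhds (hψU hy))).hasFDerivAt
  have c : ∀ w : E, HasFDerivAt (fun _ : E => w) (0 : E →L[ℝ] E) y := fun w =>
    hasFDerivAt_const w y
  have h1 := ((h0.clm_apply (c v)).clm_apply (c z))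
  have h01 : HasFDerivAt (fun x => G' (ψ x))
      (fderiv ℝ G' (ψ y) ∘L fderiv ℝ ψ y) y := HasFDerivAt.comp (g := G') y h0' hψ1
  have h2 := (h01.clm_apply (hψ2.clm_apply (c v))).clm_apply (hψ2.clm_apply (c z))
  have h3 : (fun x => G x v z) =ᶠ[nhds y]
      fun x => G' (ψ x) (fderiv ℝ ψ x v) (fderiv ℝ ψ x z) := by
    filter_upwards [hO.mem_nhds hy] with x hx
    rw [hGG' x hx]; rfl
  have h4 := DFunLike.congr_fun (h1.unique (h2.congr_of_eventuallyEq h3)) u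
  simp at h4
  linarith

variable [FiniteDimensional ℝ E]

/-- The transformation law of the Christoffel symbols. -/
theorem fderiv_apply_christoffel (hO : IsOpen O) (hU : IsOpen U) (hψ : ContDiffOn ℝ ∞ ψ O)
    (hψU : MapsTo ψ O U) (hG : DifferentiableOn ℝ G O) (hG' : DifferentiableOn ℝ G' U)
    (hGG' : ∀ y ∈ O, G y = pullForm (G' (ψ y)) (fderiv ℝ ψ y))
    (hinv : ∀ y ∈ O, (G y).IsInvertible) (hinv' : ∀ y ∈ U, (G' y).IsInvertible)
    (hsymm : ∀ y ∈ U, ∀ v w, G' y v w = G' y w v)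
    (hψinv : ∀ y ∈ O, (fderiv ℝ ψ y).IsInvertible) {y : E} (hy : y ∈ O) (u v : E) :
    fderiv ℝ ψ y (christoffel G y u v) =
      christoffel G' (ψ y) (fderiv ℝ ψ y u) (fderiv ℝ ψ y v) + fderiv ℝ (fderiv ℝ ψ) y u v := by
  -- Lowering the index with `G'` removes both inverse metrics and leaves an identity between
  -- Christoffel symbols of the first kind.
  apply (hinv' _ (hψU hy)).injective
  ext z'
  obtain ⟨z, rfl⟩ := (hψinv y hy).surjective z'
  have hs : ∀ a b, fderiv ℝ (fderiv ℝ ψ) y a b = fderiv ℝ (fderiv ℝ ψ) y b a := fun a b =>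
    (hψ.contDiffAt (hO.mem_nhds hy)).isSymmSndFDerivAt (by simp [two_le_infty]) a b
  have h1 : G' (ψ y) (fderiv ℝ ψ y (christoffel G y u v)) (fderiv ℝ ψ y z) =
      G y (christoffel G y u v) z := by rw [hGG' y hy, pullForm_apply]
  rw [h1, apply_christoffel (hinv y hy), map_add, add_apply,
    apply_christoffel (hinv' _ (hψU hy))]
  simp only [fderiv_pullForm hO hU hψ hψU hG hG' hGG' hy]
  -- Of the six terms containing `D²ψ`, symmetry cancels four; the other two are equal and absorb
  -- the factor `1/2`.
  rw [hs v u, hs z u, hs z v, hsymm _ (hψU hy) (fderiv ℝ (fderiv ℝ ψ) y u z),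
    hsymm _ (hψU hy) (fderiv ℝ (fderiv ℝ ψ) y u v)]
  ring

/-- The curvature tensor does not depend on the coordinates. -/
theorem fderiv_apply_curvatureEnd (hO : IsOpen O) (hU : IsOpen U) (hψ : ContDiffOn ℝ ∞ ψ O)
    (hψU : MapsTo ψ O U) (hG : DifferentiableOn ℝ G O) (hG' : DifferentiableOn ℝ G' U)
    (hΓ : DifferentiableOn ℝ (christoffel G) O) (hΓ' : DifferentiableOn ℝ (christoffel G') U)
    (hGG' : ∀ y ∈ O, G y = pullForm (G' (ψ y)) (fderiv ℝ ψ y))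
    (hinv : ∀ y ∈ O, (G y).IsInvertible) (hinv' : ∀ y ∈ U, (G' y).IsInvertible)
    (hsymm : ∀ y ∈ U, ∀ v w, G' y v w = G' y w v)
    (hψinv : ∀ y ∈ O, (fderiv ℝ ψ y).IsInvertible) {y : E} (hy : y ∈ O) (v w u : E) :
    fderiv ℝ ψ y (curvatureEnd G y v w u) =
      curvatureEnd G' (ψ y) (fderiv ℝ ψ y v) (fderiv ℝ ψ y w) (fderiv ℝ ψ y u) := by
  have hψy := hψ.contDiffAt (hO.mem_nhds hy)
  have hψ1 : HasFDerivAt ψ (fderiv ℝ ψ y) y := (hψy.differentiableAt (by simp)).hasFDerivAt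
  have hψ2' : ContDiffAt ℝ ∞ (fderiv ℝ ψ) y := hψy.fderiv_right (by simp)
  have hψ2 : HasFDerivAt (fderiv ℝ ψ) (fderiv ℝ (fderiv ℝ ψ) y) y :=
    (hψ2'.differentiableAt (by simp)).hasFDerivAt
  have hψ3 : HasFDerivAt (fderiv ℝ (fderiv ℝ ψ)) (fderiv ℝ (fderiv ℝ (fderiv ℝ ψ)) y) y :=
    ((hψ2'.fderiv_right (m := ∞) (by simp)).differentiableAt (by simp)).hasFDerivAt
  have h0 : HasFDerivAt (christoffel G) (fderiv ℝ (christoffel G) y) y :=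
    ((hΓ y hy).differentiableAt (hO.mem_nhds hy)).hasFDerivAt
  have h0' : HasFDerivAt (christoffel G') (fderiv ℝ (christoffel G') (ψ y)) (ψ y) :=
    ((hΓ' _ (hψU hy)).differentiableAt (hU.mem_nhds (hψU hy))).hasFDerivAt
  have c : ∀ w : E, HasFDerivAt (fun _ : E => w) (0 : E →L[ℝ] E) y := fun w =>
    hasFDerivAt_const w y
  have T : ∀ u v : E, fderiv ℝ ψ y (christoffel G y u v) =
      christoffel G' (ψ y) (fderiv ℝ ψ y u) (fderiv ℝ ψ y v) + fderiv ℝ (fderiv ℝ ψ) y u v :=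
    fun u v =>
      fderiv_apply_christoffel hO hU hψ hψU hG hG' hGG' hinv hinv' hsymm hψinv hy u v
  -- The derivative of the transformation law `T` in the direction `u`, solved for the term in the
  -- derivative of `christoffel G`.
  have D : ∀ u v w : E, fderiv ℝ ψ y (fderiv ℝ (christoffel G) y u v w) =
      fderiv ℝ (christoffel G') (ψ y) (fderiv ℝ ψ y u) (fderiv ℝ ψ y v) (fderiv ℝ ψ y w)
      + christoffel G' (ψ y) (fderiv ℝ (fderiv ℝ ψ) y u v) (fderiv ℝ ψ y w)
      + christoffel G' (ψ y) (fderiv ℝ ψ y v) (fderiv ℝ (fderiv ℝ ψ) y u w)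
      + fderiv ℝ (fderiv ℝ (fderiv ℝ ψ)) y u v w
      - fderiv ℝ (fderiv ℝ ψ) y u (christoffel G y v w) := by
    intro u v w
    have h1 := hψ2.clm_apply ((h0.clm_apply (c v)).clm_apply (c w))
    have h01 : HasFDerivAt (fun x => christoffel G' (ψ x))
        (fderiv ℝ (christoffel G') (ψ y) ∘L fderiv ℝ ψ y) y :=
      HasFDerivAt.comp (g := christoffel G') y h0' hψ1
    have h2 := ((h01.clm_apply (hψ2.clm_apply (c v))).clm_apply
      (hψ2.clm_apply (c w))).add ((hψ3.clm_apply (c v)).clm_apply (c w))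
    have h3 : (fun x => fderiv ℝ ψ x (christoffel G x v w)) =ᶠ[nhds y]
        fun x => christoffel G' (ψ x) (fderiv ℝ ψ x v) (fderiv ℝ ψ x w)
          + fderiv ℝ (fderiv ℝ ψ) x v w := by
      filter_upwards [hO.mem_nhds hy] with x hx
      exact fderiv_apply_christoffel hO hU hψ hψU hG hG' hGG' hinv hinv' hsymm hψinv hx v w
    have h4 := DFunLike.congr_fun (h1.unique (h2.congr_of_eventuallyEq h3)) u
    simp at h4
    rw [eq_sub_iff_add_eq, h4]
    abel
  -- Antisymmetrisation in `u, v` removes `D³ψ` and the terms containing `D²ψ(u, v)`. The remaining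
  -- second-derivative terms cancel those that `T` produces from the quadratic part of the
  -- curvature.
  have hs3 : fderiv ℝ (fderiv ℝ (fderiv ℝ ψ)) y v u w =
      fderiv ℝ (fderiv ℝ (fderiv ℝ ψ)) y u v w :=
    DFunLike.congr_fun (hψ2'.isSymmSndFDerivAt (by simp [two_le_infty]) v u) w
  have hs2 : fderiv ℝ (fderiv ℝ ψ) y v u = fderiv ℝ (fderiv ℝ ψ) y u v :=
    hψy.isSymmSndFDerivAt (by simp [two_le_infty]) v u
  simp only [curvatureEnd_apply, map_sub, map_add]
  rw [D u v w, D v u w, T u, T v (christoffel G y u w), T v w, T u w, hs3, hs2]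
  simp only [map_add]
  abel

theorem coordRicci_pullForm (hO : IsOpen O) (hU : IsOpen U) (hψ : ContDiffOn ℝ ∞ ψ O)
    (hψU : MapsTo ψ O U) (hG : DifferentiableOn ℝ G O) (hG' : DifferentiableOn ℝ G' U)
    (hΓ : DifferentiableOn ℝ (christoffel G) O) (hΓ' : DifferentiableOn ℝ (christoffel G') U)
    (hGG' : ∀ y ∈ O, G y = pullForm (G' (ψ y)) (fderiv ℝ ψ y))
    (hinv : ∀ y ∈ O, (G y).IsInvertible) (hinv' : ∀ y ∈ U, (G' y).IsInvertible)
    (hsymm : ∀ y ∈ U, ∀ v w, G' y v w = G' y w v)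
    (hψinv : ∀ y ∈ O, (fderiv ℝ ψ y).IsInvertible) {y : E} (hy : y ∈ O) :
    coordRicci G y = pullForm (coordRicci G' (ψ y)) (fderiv ℝ ψ y) := by
  ext v w
  rw [pullForm_apply, coordRicci_apply, coordRicci_apply]
  have key : ∀ u, fderiv ℝ ψ y (curvatureEnd G y v w u) =
      curvatureEnd G' (ψ y) (fderiv ℝ ψ y v) (fderiv ℝ ψ y w) (fderiv ℝ ψ y u) :=
    fderiv_apply_curvatureEnd hO hU hψ hψU hG hG' hΓ hΓ' hGG' hinv hinv' hsymm hψinv hy v w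
  obtain ⟨e, he⟩ := hψinv y hy
  -- By `key`, `Dψ` conjugates one curvature endomorphism into the other, so their traces agree.
  rw [← LinearMap.trace_conj' (curvatureEnd G y v w).toLinearMap e.toLinearEquiv]
  congr 1
  ext u
  have h := key (e.symm u)
  rw [← he] at h ⊢
  simpa [LinearEquiv.conj_apply] using h

end ChangeOfCoordinates

/-! ### The metric in a chart -/

section ManifoldCharts

variable {n : ℕ} {M : Type*} [TopologicalSpace M] [ChartedSpace (EuclideanSpace ℝ (Fin n)) M]

theorem chart_mem_target {p x : M} (hx : x ∈ (extChartAt (𝓡 n) p).source) :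
    extChartAt (𝓡 n) p x ∈ (extChartAt (𝓡 n) p).target :=
  (extChartAt (𝓡 n) p).map_source hx

theorem mfderivWithin_chart_symm (p : M) (y : EuclideanSpace ℝ (Fin n)) :
    mfderivWithin 𝓘(ℝ, EuclideanSpace ℝ (Fin n)) (𝓡 n) (extChartAt (𝓡 n) p).symm (range (𝓡 n)) y =
      dChartSymm p y := by
  simp only [ModelWithCorners.range_eq_univ, mfderivWithin_univ, dChartSymm]

theorem chartMetric_symm (g : Bundle.RiemannianMetric (fun x : M => TangentSpace (𝓡 n) x))
    (p : M) (y u v : EuclideanSpace ℝ (Fin n)) :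
    chartMetric g p y u v = chartMetric g p y v u :=
  g.symm _ _ _

theorem isInvertible_inner (g : Bundle.RiemannianMetric (fun x : M => TangentSpace (𝓡 n) x))
    (x : M) : (g.inner x).IsInvertible :=
  isInvertible_of_pos (E := EuclideanSpace ℝ (Fin n)) (g.pos x)

theorem three_le_infty : (3 : ℕ∞ω) ≤ ∞ :=
  WithTop.coe_le_coe.2 (le_top : (3 : ℕ∞) ≤ ⊤)

variable [IsManifold (𝓡 n) ∞ M]

theorem isInvertible_dChart {p x : M} (hx : x ∈ (extChartAt (𝓡 n) p).source) :
    (dChart (n := n) p x).IsInvertible :=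
  isInvertible_mfderiv_extChartAt hx

theorem isInvertible_dChartSymm {p : M} {y : EuclideanSpace ℝ (Fin n)}
    (hy : y ∈ (extChartAt (𝓡 n) p).target) : (dChartSymm p y).IsInvertible := by
  rw [← mfderivWithin_chart_symm]
  exact isInvertible_mfderivWithin_extChartAt_symm hy

theorem dChartSymm_dChart {p x : M} (hx : x ∈ (extChartAt (𝓡 n) p).source)
    (v : TangentSpace (𝓡 n) x) :
    (dChartSymm p (extChartAt (𝓡 n) p x) (dChart p x v) : EuclideanSpace ℝ (Fin n)) = v := by
  have h := mfderivWithin_extChartAt_symm_comp_mfderiv_extChartAt' (I := 𝓡 n) hx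
  rw [mfderivWithin_chart_symm] at h
  exact DFunLike.congr_fun h v

theorem dChart_dChartSymm {p : M} {y : EuclideanSpace ℝ (Fin n)}
    (hy : y ∈ (extChartAt (𝓡 n) p).target) (v : EuclideanSpace ℝ (Fin n)) :
    dChart p ((extChartAt (𝓡 n) p).symm y) (dChartSymm p y v) = v := by
  have h := mfderiv_extChartAt_comp_mfderivWithin_extChartAt_symm (I := 𝓡 n) hy
  rw [mfderivWithin_chart_symm] at h
  exact DFunLike.congr_fun h v

/-- The metric in terms of its coefficients in a chart. -/
theorem inner_eq_chartMetric (g : Bundle.RiemannianMetric (fun x : M => TangentSpace (𝓡 n) x))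
    {p x : M} (hx : x ∈ (extChartAt (𝓡 n) p).source) (v w : TangentSpace (𝓡 n) x) :
    g.inner x v w = chartMetric g p (extChartAt (𝓡 n) p x) (dChart p x v) (dChart p x w) := by
  -- The point `symm (chart x)` equals `x` only propositionally, so the tangent spaces are different
  -- types. Generalising the point allows the equality to be eliminated.
  have key : ∀ (z : M) (_ : z = x) (v' w' : TangentSpace (𝓡 n) z),
      (v' : EuclideanSpace ℝ (Fin n)) = v → (w' : EuclideanSpace ℝ (Fin n)) = w →
      g.inner x v w = g.inner z v' w' := by
    rintro z rfl v' w' rfl rfl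
    rfl
  exact key _ ((extChartAt (𝓡 n) p).left_inv hx) _ _ (dChartSymm_dChart hx v)
    (dChartSymm_dChart hx w)

theorem isInvertible_chartMetric
    (g : Bundle.RiemannianMetric (fun x : M => TangentSpace (𝓡 n) x))
    {p : M} {y : EuclideanSpace ℝ (Fin n)} (hy : y ∈ (extChartAt (𝓡 n) p).target) :
    (chartMetric g p y).IsInvertible := by
  refine isInvertible_of_pos fun v hv => g.pos _ _ fun h => hv ?_
  rw [← dChart_dChartSymm hy v]
  exact (congrArg (dChart p _) h).trans (map_zero _)

/-- Converts regularity of a bundle section into regularity of coefficients: the metric is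
contracted with the coordinate fields of the chart, which are smooth sections because they come from
the tangent map of the inverse chart. -/
theorem contDiffOn_chartMetric {J : Set ℝ}
    {g : ℝ → Bundle.RiemannianMetric (fun x : M => TangentSpace (𝓡 n) x)}
    (hg : IsMetricFamilyOfClass 3 J g) (p : M) :
    ContDiffOn ℝ 3 (Function.uncurry fun t => chartMetric (g t) p)
      (J ×ˢ (extChartAt (𝓡 n) p).target) := by
  rw [contDiffOn_clm_apply]
  intro u
  rw [contDiffOn_clm_apply]
  intro v
  rw [← contMDiffOn_iff_contDiffOn]
  have hb : ContMDiffOn 𝓘(ℝ, ℝ × EuclideanSpace ℝ (Fin n)) (𝓡 n) ∞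
      (fun q : ℝ × EuclideanSpace ℝ (Fin n) => (extChartAt (𝓡 n) p).symm q.2)
      (J ×ˢ (extChartAt (𝓡 n) p).target) :=
    (contMDiffOn_extChartAt_symm p).comp contDiff_snd.contMDiff.contMDiffOn (fun q hq => hq.2)
  have hψ : ContMDiffOn 𝓘(ℝ, ℝ × EuclideanSpace ℝ (Fin n)) _ 3 _
      (J ×ˢ (extChartAt (𝓡 n) p).target) :=
    ContMDiffOn.comp (E := ℝ × EuclideanSpace ℝ (Fin n)) hg
      (f := fun q : ℝ × EuclideanSpace ℝ (Fin n) => (q.1, (extChartAt (𝓡 n) p).symm q.2))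
      (ContMDiffOn.prodMk contDiff_fst.contMDiff.contMDiffOn (hb.of_le (three_le_infty)))
      (fun q hq => ⟨hq.1, mem_univ _⟩)
  have hs : ∀ w : EuclideanSpace ℝ (Fin n),
      ContMDiffOn 𝓘(ℝ, ℝ × EuclideanSpace ℝ (Fin n))
        ((𝓡 n).prod 𝓘(ℝ, EuclideanSpace ℝ (Fin n))) 3
        (fun q : ℝ × EuclideanSpace ℝ (Fin n) =>
          Bundle.TotalSpace.mk' (EuclideanSpace ℝ (Fin n)) (E := fun x : M => TangentSpace (𝓡 n) x)
            ((extChartAt (𝓡 n) p).symm q.2) (dChartSymm p q.2 w))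
        (J ×ˢ (extChartAt (𝓡 n) p).target) := by
    intro w
    have h1 := (contMDiffOn_extChartAt_symm (I := 𝓡 n) (n := ∞) p).contMDiffOn_tangentMapWithin
      (m := 3) (WithTop.coe_le_coe.2 (le_top : (4 : ℕ∞) ≤ ⊤))
      (isOpen_extChartAt_target p).uniqueMDiffOn
    have hw : ContMDiff 𝓘(ℝ, EuclideanSpace ℝ (Fin n))
        𝓘(ℝ, EuclideanSpace ℝ (Fin n)).tangent 3 (fun y : EuclideanSpace ℝ (Fin n) =>
          (⟨y, w⟩ : TangentBundle 𝓘(ℝ, EuclideanSpace ℝ (Fin n)) (EuclideanSpace ℝ (Fin n)))) :=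
      contMDiff_vectorSpace_iff_contDiff.2 contDiff_const
    have h2 : ContMDiffOn 𝓘(ℝ, ℝ × EuclideanSpace ℝ (Fin n)) _ 3 _ _ := h1.comp
      (hw.comp contDiff_snd.contMDiff).contMDiffOn (s := J ×ˢ (extChartAt (𝓡 n) p).target)
      (fun q hq => hq.2)
    refine h2.congr fun q hq => ?_
    simp only [Function.comp_def, tangentMapWithin]
    rw [mfderivWithin_of_isOpen (isOpen_extChartAt_target p) hq.2]
    rfl
  have h := ContMDiffOn.clm_bundle_apply₂ (F₁ := EuclideanSpace ℝ (Fin n))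
    (F₂ := EuclideanSpace ℝ (Fin n)) (F₃ := ℝ) (E₁ := fun x : M => TangentSpace (𝓡 n) x)
    (E₂ := fun x : M => TangentSpace (𝓡 n) x) (E₃ := fun _ : M => ℝ) hψ (hs u) (hs v)
  intro q hq
  have h3 := h q hq
  rw [Bundle.contMDiffWithinAt_totalSpace] at h3
  exact h3.2

end ManifoldCharts

/-- A family of linear maps on a finite-dimensional space is differentiable as soon as it is so
pointwise. -/
theorem hasDerivWithinAt_clm_of_apply {E F : Type*} [NormedAddCommGroup E] [NormedSpace ℝ E]
    [FiniteDimensional ℝ E] [NormedAddCommGroup F] [NormedSpace ℝ F] {f : ℝ → E →L[ℝ] F}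
    {f' : E →L[ℝ] F} {J : Set ℝ} {t : ℝ}
    (h : ∀ v, HasDerivWithinAt (fun s => f s v) (f' v) J t) : HasDerivWithinAt f f' J t := by
  let b := Module.finBasis ℝ E
  have hsum : ∀ A : E →L[ℝ] F, A = ∑ i, ContinuousLinearMap.smulRightL ℝ E F
      (LinearMap.toContinuousLinearMap (b.coord i)) (A (b i)) := by
    intro A
    ext v
    conv_lhs => rw [← b.sum_repr v, map_sum]
    simp only [map_smul, sum_apply]
    rfl
  have hf : f = fun s => ∑ i, ContinuousLinearMap.smulRightL ℝ E F
      (LinearMap.toContinuousLinearMap (b.coord i)) (f s (b i)) := funext fun s => hsum (f s)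
  rw [hf, hsum f']
  exact HasDerivWithinAt.fun_sum fun i _ =>
    (ContinuousLinearMap.hasFDerivAt _).comp_hasDerivWithinAt t (h (b i))

/-! ### The reduced Lagrangian; curvature in an arbitrary chart -/

section Curvature

variable {n : ℕ} {M : Type*} [TopologicalSpace M] [ChartedSpace (EuclideanSpace ℝ (Fin n)) M]

theorem divergence_zero (g : Bundle.RiemannianMetric (fun x : M => TangentSpace (𝓡 n) x)) (x : M) :
    divergence g (fun _ => 0) x = 0 := by
  simp only [divergence, map_zero]
  have h : fderiv ℝ (fun _ : EuclideanSpace ℝ (Fin n) => (0 : EuclideanSpace ℝ (Fin n)))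
      (extChartAt (𝓡 n) x x) = 0 := fderiv_const_apply 0
  rw [h]
  simp

/-- The flow equation holds for each pair of vectors, whereas `metricDot` is a derivative in the
normed space of bilinear forms; finite dimension bridges the two. -/
theorem metricDot_eq {α : ℝ} {J : Set ℝ} (hJ : UniqueDiffOn ℝ J)
    {g : ℝ → Bundle.RiemannianMetric (fun x : M => TangentSpace (𝓡 n) x)}
    (hflow : IsRicciFlow α J g) {t : ℝ} (ht : t ∈ J) (x : M) :
    metricDot J g t x = α • ricci (g t) x := by
  -- Tangent spaces are read as the model space, which supplies the norm.
  let f : ℝ → EuclideanSpace ℝ (Fin n) →L[ℝ] EuclideanSpace ℝ (Fin n) →L[ℝ] ℝ :=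
    fun s => (g s).inner x
  let A : EuclideanSpace ℝ (Fin n) →L[ℝ] EuclideanSpace ℝ (Fin n) →L[ℝ] ℝ := α • ricci (g t) x
  have hA : ∀ v w : EuclideanSpace ℝ (Fin n), HasDerivWithinAt (fun s => f s v w) (A v w) J t :=
    fun v w => hflow t ht x v w
  have h : HasDerivWithinAt f A J t :=
    hasDerivWithinAt_clm_of_apply fun v => hasDerivWithinAt_clm_of_apply (hA v)
  exact HasDerivWithinAt.derivWithin
    (F := EuclideanSpace ℝ (Fin n) →L[ℝ] EuclideanSpace ℝ (Fin n) →L[ℝ] ℝ) h (hJ t ht)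

/-- The trace of `∂_t g` is `α R`, and `-1/12 + α/4 = -(1 - 3α)/12`. -/
theorem lagrangian_eq {α : ℝ} {J : Set ℝ} (hJ : UniqueDiffOn ℝ J)
    {g : ℝ → Bundle.RiemannianMetric (fun x : M => TangentSpace (𝓡 n) x)}
    (hflow : IsRicciFlow α J g) {t : ℝ} (ht : t ∈ J) (x : M) (v : TangentSpace (𝓡 n) x) :
    lagrangian J g (fun _ _ => 0) t x v =
      1 / 2 * (g t).inner x v v - (1 - 3 * α) / 12 * scalarCurvature (g t) x := by
  have h1 : metricTrace (g t) x (metricDot J g t x) = α * scalarCurvature (g t) x := by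
    rw [metricDot_eq hJ hflow ht, scalarCurvature, metricTrace, metricTrace, sharp, sharp,
      ContinuousLinearMap.comp_smul]
    exact map_smul (LinearMap.trace ℝ (TangentSpace (𝓡 n) x)) α _
  rw [lagrangian, h1, divergence_zero, zero_sub]
  simp only [map_neg, neg_apply, neg_neg]
  ring

variable [IsManifold (𝓡 n) ∞ M]

/-- The differential of a change of charts. -/
theorem fderiv_coordChange {p q : M} {y : EuclideanSpace ℝ (Fin n)}
    (hy : y ∈ (extChartAt (𝓡 n) q).target)
    (hyp : (extChartAt (𝓡 n) q).symm y ∈ (extChartAt (𝓡 n) p).source) :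
    fderiv ℝ (fun z => extChartAt (𝓡 n) p ((extChartAt (𝓡 n) q).symm z)) y =
      (dChart p ((extChartAt (𝓡 n) q).symm y)) ∘L dChartSymm q y := by
  have h1 : MDifferentiableAt 𝓘(ℝ, EuclideanSpace ℝ (Fin n)) (𝓡 n) (extChartAt (𝓡 n) q).symm y :=
    ((contMDiffOn_extChartAt_symm (I := 𝓡 n) (n := ∞) q).contMDiffAt
      ((isOpen_extChartAt_target q).mem_nhds hy)).mdifferentiableAt (by simp)
  have h2 : MDifferentiableAt (𝓡 n) 𝓘(ℝ, EuclideanSpace ℝ (Fin n)) (extChartAt (𝓡 n) p)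
      ((extChartAt (𝓡 n) q).symm y) :=
    mdifferentiableAt_extChartAt (by rwa [extChartAt_source] at hyp)
  rw [← mfderiv_eq_fderiv]
  exact mfderiv_comp y h2 h1

theorem contDiffOn_coordChange (p q : M) :
    ContDiffOn ℝ ∞ (fun z => extChartAt (𝓡 n) p ((extChartAt (𝓡 n) q).symm z))
      ((extChartAt (𝓡 n) q).target ∩
        (extChartAt (𝓡 n) q).symm ⁻¹' (extChartAt (𝓡 n) p).source) := by
  rw [← contMDiffOn_iff_contDiffOn]
  refine ContMDiffOn.comp (t := (extChartAt (𝓡 n) p).source) ?_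
    ((contMDiffOn_extChartAt_symm q).mono inter_subset_left) (fun z hz => hz.2)
  rw [extChartAt_source]
  exact contMDiffOn_extChartAt

theorem mdifferentiableAt_chart {p x : M} (hx : x ∈ (extChartAt (𝓡 n) p).source) :
    MDifferentiableAt (𝓡 n) 𝓘(ℝ, EuclideanSpace ℝ (Fin n)) (extChartAt (𝓡 n) p) x :=
  mdifferentiableAt_extChartAt (by rwa [extChartAt_source] at hx)

variable {J : Set ℝ} {g : ℝ → Bundle.RiemannianMetric (fun x : M => TangentSpace (𝓡 n) x)}

/-- The Ricci tensor can be computed in any chart. -/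
theorem ricci_eq_chart (hJ : UniqueDiffOn ℝ J) (hg : IsMetricFamilyOfClass 3 J g) {t : ℝ}
    (ht : t ∈ J) {p x : M} (hx : x ∈ (extChartAt (𝓡 n) p).source) :
    ricci (g t) x =
      pullForm (coordRicci (chartMetric (g t) p) (extChartAt (𝓡 n) p x)) (dChart p x) := by
  have hG : ∀ q : M, DifferentiableOn ℝ (chartMetric (g t) q) (extChartAt (𝓡 n) q).target :=
    fun q => (contDiffOn_slice (contDiffOn_chartMetric hg q) ht).differentiableOn (by simp)
  have hΓ : ∀ q : M, DifferentiableOn ℝ (christoffel (chartMetric (g t) q))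
      (extChartAt (𝓡 n) q).target := fun q =>
    (contDiffOn_slice (contDiffOn_christoffel hJ (isOpen_extChartAt_target q) (m := 2) (by rfl)
      (contDiffOn_chartMetric hg q) fun s _ y hy => isInvertible_chartMetric (g s) hy)
      ht).differentiableOn (by simp)
  set ψ : EuclideanSpace ℝ (Fin n) → EuclideanSpace ℝ (Fin n) :=
    fun z => extChartAt (𝓡 n) p ((extChartAt (𝓡 n) x).symm z) with hψ
  have hxx : x ∈ (extChartAt (𝓡 n) x).source := mem_extChartAt_source x
  have hx0 : (extChartAt (𝓡 n) x).symm (extChartAt (𝓡 n) x x) = x :=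
    (extChartAt (𝓡 n) x).left_inv hxx
  have hmem : extChartAt (𝓡 n) x x ∈ (extChartAt (𝓡 n) x).target ∩
      (extChartAt (𝓡 n) x).symm ⁻¹' (extChartAt (𝓡 n) p).source :=
    ⟨mem_extChartAt_target x, by rwa [mem_preimage, hx0]⟩
  have hO : IsOpen ((extChartAt (𝓡 n) x).target ∩
      (extChartAt (𝓡 n) x).symm ⁻¹' (extChartAt (𝓡 n) p).source) :=
    (continuousOn_extChartAt_symm x).isOpen_inter_preimage (isOpen_extChartAt_target x)
      (isOpen_extChartAt_source p)
  have hRic := coordRicci_pullForm (G := chartMetric (g t) x) (G' := chartMetric (g t) p) (ψ := ψ)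
    hO (isOpen_extChartAt_target p) (contDiffOn_coordChange p x) (fun z hz => chart_mem_target hz.2)
    ((hG x).mono inter_subset_left) (hG p) ((hΓ x).mono inter_subset_left) (hΓ p)
    (fun y hy => by
      ext u v
      rw [fderiv_coordChange hy.1 hy.2]
      exact inner_eq_chartMetric (g t) hy.2 _ _)
    (fun y hy => isInvertible_chartMetric (g t) hy.1)
    (fun y hy => isInvertible_chartMetric (g t) hy)
    (fun y _ => chartMetric_symm (g t) p y)
    (fun y hy => by
      rw [fderiv_coordChange hy.1 hy.2]
      exact (isInvertible_dChart hy.2).comp (isInvertible_dChartSymm hy.1)) hmem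
  have hψx : ψ (extChartAt (𝓡 n) x x) = extChartAt (𝓡 n) p x := by rw [hψ]; simp only [hx0]
  -- Near `x` the chart at `p` is `ψ` after the chart at `x`; this is the chain rule for that
  -- factorisation.
  have hd : dChart p x = fderiv ℝ ψ (extChartAt (𝓡 n) x x) ∘L dChart x x := by
    have hψd : MDifferentiableAt 𝓘(ℝ, EuclideanSpace ℝ (Fin n)) 𝓘(ℝ, EuclideanSpace ℝ (Fin n)) ψ
        (extChartAt (𝓡 n) x x) :=
      (((contDiffOn_coordChange p x).contDiffAt (hO.mem_nhds hmem)).differentiableAt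
        (by simp)).mdifferentiableAt
    have h1 := mfderiv_comp x hψd (mdifferentiableAt_chart hxx)
    rw [mfderiv_eq_fderiv] at h1
    refine Eq.trans (Filter.EventuallyEq.mfderiv_eq ?_) h1
    filter_upwards [(isOpen_extChartAt_source x).mem_nhds hxx] with z hz
    simp only [hψ, Function.comp_apply, (extChartAt (𝓡 n) x).left_inv hz]
  rw [ricci, hRic, hd, hψx]
  rfl

/-- The scalar curvature can be computed in any chart. -/
theorem scalarCurvature_eq_chart (hJ : UniqueDiffOn ℝ J) (hg : IsMetricFamilyOfClass 3 J g) {t : ℝ}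
    (ht : t ∈ J) {p x : M} (hx : x ∈ (extChartAt (𝓡 n) p).source) :
    scalarCurvature (g t) x = coordScalar (chartMetric (g t) p) (extChartAt (𝓡 n) p x) := by
  have hB : (g t).inner x =
      pullForm (chartMetric (g t) p (extChartAt (𝓡 n) p x)) (dChart p x) := by
    ext v w
    exact inner_eq_chartMetric (g t) hx v w
  have hinv := isInvertible_inner (g t) x
  rw [scalarCurvature, metricTrace, sharp, ricci_eq_chart hJ hg ht hx]
  rw [hB] at hinv ⊢
  exact trace_inverse_pullForm (isInvertible_chartMetric (g t) (chart_mem_target hx))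
    (isInvertible_dChart hx) hinv

/-- Curvature involves two derivatives of the metric, so one of the three remains. This is the
regularity needed to form the gradient of `R` and to differentiate the energy. -/
theorem contDiffOn_coordScalar_chartMetric (hJ : UniqueDiffOn ℝ J)
    (hg : IsMetricFamilyOfClass 3 J g) (p : M) :
    ContDiffOn ℝ 1 (Function.uncurry fun t => coordScalar (chartMetric (g t) p))
      (J ×ˢ (extChartAt (𝓡 n) p).target) :=
  contDiffOn_coordScalar hJ (isOpen_extChartAt_target p) (m := 2) (k := 3) (by rfl) (by rfl)
    (contDiffOn_chartMetric hg p) fun s _ _ hy => isInvertible_chartMetric (g s) hy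

end Curvature

/-! ### First variation in coordinates -/

section CoordinateVariation

variable {E : Type*} [NormedAddCommGroup E] [NormedSpace ℝ E]
  {I J : Set ℝ} {U : Set E} {G : ℝ → E → E →L[ℝ] E →L[ℝ] ℝ} {ρ : ℝ → E → ℝ}
  {c : ℝ × ℝ → E} {q : ℝ × ℝ}

/-- The Lagrangian `½ G(ċ, ċ) - κ ρ` along a family of curves `c(s, t)` in coordinates. -/
def coordLagrangian (I J : Set ℝ) (κ : ℝ) (G : ℝ → E → E →L[ℝ] E →L[ℝ] ℝ) (ρ : ℝ → E → ℝ)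
    (c : ℝ × ℝ → E) (q : ℝ × ℝ) : ℝ :=
  1 / 2 * G q.2 (c q) (fderivWithin ℝ c (I ×ˢ J) q (0, 1)) (fderivWithin ℝ c (I ×ˢ J) q (0, 1))
    - κ * ρ q.2 (c q)

/-- The pairing `G(ċ, ∂_s c)` of the momentum with the variation field in coordinates. -/
def coordMomentum (I J : Set ℝ) (G : ℝ → E → E →L[ℝ] E →L[ℝ] ℝ)
    (c : ℝ × ℝ → E) (q : ℝ × ℝ) : ℝ :=
  G q.2 (c q) (fderivWithin ℝ c (I ×ˢ J) q (0, 1)) (fderivWithin ℝ c (I ×ˢ J) q (1, 0))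

theorem contDiffWithinAt_uncurry_comp {F : Type*} [NormedAddCommGroup F] [NormedSpace ℝ F]
    {f : ℝ → E → F} (hU : IsOpen U) {k : ℕ∞ω} (hf : ContDiffOn ℝ k (Function.uncurry f) (J ×ˢ U))
    (hq : q ∈ I ×ˢ J) (hc : ContDiffWithinAt ℝ k c (I ×ˢ J) q) (hcU : c q ∈ U) :
    ContDiffWithinAt ℝ k (fun q : ℝ × ℝ => f q.2 (c q)) (I ×ˢ J) q := by
  -- The curve family need not stay in `U`; the composition is made on the part that does, which is
  -- a neighbourhood of `q` within the strip.
  have h1 : ContDiffWithinAt ℝ k (fun q : ℝ × ℝ => (q.2, c q)) (I ×ˢ J ∩ c ⁻¹' U) q :=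
    (contDiffWithinAt_snd.prodMk hc).mono inter_subset_left
  refine (ContDiffWithinAt.comp (t := J ×ˢ U) (g := Function.uncurry f) q (hf (q.2, c q) ⟨hq.2, hcU⟩) h1
    (fun z hz => ⟨hz.1.2, hz.2⟩)).mono_of_mem_nhdsWithin ?_
  exact Filter.inter_mem self_mem_nhdsWithin (hc.continuousWithinAt.preimage_mem_nhdsWithin
    (hU.mem_nhds hcU))

theorem contDiffWithinAt_partial (hI : IsOpen I) (hJ : UniqueDiffOn ℝ J) (hq : q ∈ I ×ˢ J)
    (hc : ContDiffWithinAt ℝ ∞ c (I ×ˢ J) q) (d : ℝ × ℝ) :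
    ContDiffWithinAt ℝ ∞ (fun q => fderivWithin ℝ c (I ×ˢ J) q d) (I ×ˢ J) q :=
  (hc.fderivWithin_right (hI.uniqueDiffOn.prod hJ) (by simp) hq).clm_apply contDiffWithinAt_const

theorem contDiffWithinAt_coordLagrangian (κ : ℝ) (hI : IsOpen I) (hJ : UniqueDiffOn ℝ J)
    (hU : IsOpen U) (hG : ContDiffOn ℝ 1 (Function.uncurry G) (J ×ˢ U))
    (hρ : ContDiffOn ℝ 1 (Function.uncurry ρ) (J ×ˢ U)) (hq : q ∈ I ×ˢ J)
    (hc : ContDiffWithinAt ℝ ∞ c (I ×ˢ J) q) (hcU : c q ∈ U) :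
    ContDiffWithinAt ℝ 1 (coordLagrangian I J κ G ρ c) (I ×ˢ J) q := by
  have h1 : (1 : ℕ∞ω) ≤ ∞ := by simp
  have hd := (contDiffWithinAt_partial hI hJ hq hc (0, 1)).of_le h1
  exact (contDiffWithinAt_const.mul
    (((contDiffWithinAt_uncurry_comp hU hG hq (hc.of_le h1) hcU).clm_apply hd).clm_apply hd)).sub
    (contDiffWithinAt_const.mul (contDiffWithinAt_uncurry_comp hU hρ hq (hc.of_le h1) hcU))

theorem contDiffWithinAt_coordMomentum (hI : IsOpen I) (hJ : UniqueDiffOn ℝ J)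
    (hU : IsOpen U) (hG : ContDiffOn ℝ 1 (Function.uncurry G) (J ×ˢ U)) (hq : q ∈ I ×ˢ J)
    (hc : ContDiffWithinAt ℝ ∞ c (I ×ˢ J) q) (hcU : c q ∈ U) :
    ContDiffWithinAt ℝ 1 (coordMomentum I J G c) (I ×ˢ J) q := by
  have h1 : (1 : ℕ∞ω) ≤ ∞ := by simp
  exact ((contDiffWithinAt_uncurry_comp hU hG hq (hc.of_le h1) hcU).clm_apply
    ((contDiffWithinAt_partial hI hJ hq hc (0, 1)).of_le h1)).clm_apply
    ((contDiffWithinAt_partial hI hJ hq hc (1, 0)).of_le h1)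

/-- The derivative in the second variable as a directional derivative within a product. -/
theorem hasDerivWithinAt_snd_slice {F : Type*} [NormedAddCommGroup F] [NormedSpace ℝ F]
    {f : ℝ × ℝ → F} (hq : q ∈ I ×ˢ J) (hf : DifferentiableWithinAt ℝ f (I ×ˢ J) q) :
    HasDerivWithinAt (fun t => f (q.1, t)) (fderivWithin ℝ f (I ×ˢ J) q (0, 1)) J q.2 := by
  have h1 : HasDerivWithinAt (fun t : ℝ => (q.1, t)) ((0 : ℝ), (1 : ℝ)) J q.2 :=
    (hasDerivWithinAt_const _ _ _).prodMk (hasDerivWithinAt_id _ _)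
  exact HasFDerivWithinAt.comp_hasDerivWithinAt (t := I ×ˢ J) q.2 hf.hasFDerivWithinAt h1
    (fun t ht => ⟨hq.1, ht⟩)

/-- The derivative in the first variable as a directional derivative within a product. -/
theorem hasDerivWithinAt_fst_slice {F : Type*} [NormedAddCommGroup F] [NormedSpace ℝ F]
    {f : ℝ × ℝ → F} (hq : q ∈ I ×ˢ J) (hf : DifferentiableWithinAt ℝ f (I ×ˢ J) q) :
    HasDerivWithinAt (fun s => f (s, q.2)) (fderivWithin ℝ f (I ×ˢ J) q (1, 0)) I q.1 := by
  have h1 : HasDerivWithinAt (fun s : ℝ => (s, q.2)) ((1 : ℝ), (0 : ℝ)) I q.1 :=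
    (hasDerivWithinAt_id _ _).prodMk (hasDerivWithinAt_const _ _ _)
  exact HasFDerivWithinAt.comp_hasDerivWithinAt (t := I ×ˢ J) q.1 hf.hasFDerivWithinAt h1
    (fun t ht => ⟨ht, hq.2⟩)

variable [FiniteDimensional ℝ E]

/-- The first variation formula in coordinates, before integration. -/
theorem coord_first_variation (κ : ℝ) (hI : IsOpen I) (hJ : UniqueDiffOn ℝ J)
    (hU : IsOpen U) (hG : ContDiffOn ℝ 1 (Function.uncurry G) (J ×ˢ U))
    (hρ : ContDiffOn ℝ 1 (Function.uncurry ρ) (J ×ˢ U)) (hq : q ∈ I ×ˢ J)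
    (hcl : q ∈ closure (interior (I ×ˢ J)))
    (hc : ContDiffWithinAt ℝ ∞ c (I ×ˢ J) q) (hcU : c q ∈ U)
    (hsymm : ∀ u v, G q.2 (c q) u v = G q.2 (c q) v u) (hinv : (G q.2 (c q)).IsInvertible) :
    fderivWithin ℝ (coordMomentum I J G c) (I ×ˢ J) q (0, 1)
        - fderivWithin ℝ (coordLagrangian I J κ G ρ c) (I ×ˢ J) q (1, 0) =
      fderivWithin ℝ (Function.uncurry G) (J ×ˢ U) (q.2, c q) (1, 0)
          (fderivWithin ℝ c (I ×ˢ J) q (0, 1)) (fderivWithin ℝ c (I ×ˢ J) q (1, 0))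
        + G q.2 (c q)
            (fderivWithin ℝ (fun z => fderivWithin ℝ c (I ×ˢ J) z (0, 1)) (I ×ˢ J) q (0, 1)
              + christoffel (G q.2) (c q) (fderivWithin ℝ c (I ×ˢ J) q (0, 1))
                  (fderivWithin ℝ c (I ×ˢ J) q (0, 1)))
            (fderivWithin ℝ c (I ×ˢ J) q (1, 0))
        + κ * fderiv ℝ (ρ q.2) (c q) (fderivWithin ℝ c (I ×ˢ J) q (1, 0)) := by
  have hS : UniqueDiffOn ℝ (I ×ˢ J) := hI.uniqueDiffOn.prod hJ
  have hqu : UniqueDiffWithinAt ℝ (I ×ˢ J) q := hS q hq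
  have hGd := hG.differentiableOn (by simp)
  have hρd := hρ.differentiableOn (by simp)
  have hc1 : HasFDerivWithinAt c (fderivWithin ℝ c (I ×ˢ J) q) (I ×ˢ J) q :=
    (hc.differentiableWithinAt (by simp)).hasFDerivWithinAt
  have hpair : HasFDerivWithinAt (fun z : ℝ × ℝ => (z.2, c z))
      ((ContinuousLinearMap.snd ℝ ℝ ℝ).prod (fderivWithin ℝ c (I ×ˢ J) q))
      (I ×ˢ J ∩ c ⁻¹' U) q := (hasFDerivWithinAt_snd.prodMk hc1).mono inter_subset_left
  have hmem : I ×ˢ J ∩ c ⁻¹' U ∈ nhdsWithin q (I ×ˢ J) :=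
    Filter.inter_mem self_mem_nhdsWithin (hc.continuousWithinAt.preimage_mem_nhdsWithin
      (hU.mem_nhds hcU))
  have hGc : HasFDerivWithinAt (fun z : ℝ × ℝ => G z.2 (c z))
      (fderivWithin ℝ (Function.uncurry G) (J ×ˢ U) (q.2, c q) ∘L
        (ContinuousLinearMap.snd ℝ ℝ ℝ).prod (fderivWithin ℝ c (I ×ˢ J) q)) (I ×ˢ J) q :=
    (HasFDerivWithinAt.comp (t := J ×ˢ U) (g := Function.uncurry G) q
      (hGd (q.2, c q) ⟨hq.2, hcU⟩).hasFDerivWithinAt hpair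
      (fun z hz => ⟨hz.1.2, hz.2⟩)).mono_of_mem_nhdsWithin hmem
  have hρc : HasFDerivWithinAt (fun z : ℝ × ℝ => ρ z.2 (c z))
      (fderivWithin ℝ (Function.uncurry ρ) (J ×ˢ U) (q.2, c q) ∘L
        (ContinuousLinearMap.snd ℝ ℝ ℝ).prod (fderivWithin ℝ c (I ×ˢ J) q)) (I ×ˢ J) q :=
    (HasFDerivWithinAt.comp (t := J ×ˢ U) (g := Function.uncurry ρ) q
      (hρd (q.2, c q) ⟨hq.2, hcU⟩).hasFDerivWithinAt hpair
      (fun z hz => ⟨hz.1.2, hz.2⟩)).mono_of_mem_nhdsWithin hmem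
  have hcc : HasFDerivWithinAt (fderivWithin ℝ c (I ×ˢ J))
      (fderivWithin ℝ (fderivWithin ℝ c (I ×ˢ J)) (I ×ˢ J) q) (I ×ˢ J) q :=
    ((hc.fderivWithin_right (m := ∞) hS (by simp) hq).differentiableWithinAt
      (by simp)).hasFDerivWithinAt
  have hd : ∀ d : ℝ × ℝ, HasFDerivWithinAt (fun z => fderivWithin ℝ c (I ×ˢ J) z d)
      ((fderivWithin ℝ (fderivWithin ℝ c (I ×ˢ J)) (I ×ˢ J) q).flip d) (I ×ˢ J) q := by
    intro d
    have h := hcc.clm_apply (hasFDerivWithinAt_const d q (I ×ˢ J))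
    simpa using h
  have hw := ((hGc.clm_apply (hd (0, 1))).clm_apply (hd (1, 0))).fderivWithin hqu
  have hh := ((((hGc.clm_apply (hd (0, 1))).clm_apply (hd (0, 1))).const_mul (1 / 2 : ℝ)).sub
    (hρc.const_mul κ)).fderivWithin hqu
  -- Commuting mixed partials, `∂_t ∂_s c = ∂_s ∂_t c`. The hypothesis `hcl` makes this valid also
  -- at the end times, where derivatives are one-sided.
  have hsym2 : fderivWithin ℝ (fderivWithin ℝ c (I ×ˢ J)) (I ×ˢ J) q (0, 1) (1, 0) =
      fderivWithin ℝ (fderivWithin ℝ c (I ×ˢ J)) (I ×ˢ J) q (1, 0) (0, 1) :=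
    hc.isSymmSndFDerivWithinAt (by simp [two_le_infty]) hS hcl hq (0, 1) (1, 0)
  have hslG := (hasFDerivAt_slice hU hGd hq.2 hcU).fderiv
  have hslρ := (hasFDerivAt_slice hU hρd hq.2 hcU).fderiv
  rw [(hd (0, 1)).fderivWithin hqu, map_add, add_apply, apply_christoffel hinv, hslG, hslρ]
  have hw' : fderivWithin ℝ (coordMomentum I J G c) (I ×ˢ J) q = _ := hw
  have hh' : fderivWithin ℝ (coordLagrangian I J κ G ρ c) (I ×ˢ J) q = _ := hh
  rw [hw', hh']
  set L := fderivWithin ℝ (Function.uncurry G) (J ×ˢ U) (q.2, c q)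
  set a := fderivWithin ℝ c (I ×ˢ J) q (0, 1) with ha
  set V := fderivWithin ℝ c (I ×ˢ J) q (1, 0) with hV
  -- The total time derivative of `G(t, c)` splits into the explicit part `∂_t G`, which becomes the
  -- Ricci term, and the part along `ċ`, which enters the Christoffel term.
  have hsplit : L (1, a) = L (1, 0) + L (0, a) := by rw [← map_add]; simp
  simp [hsplit, hsym2, ← ha, ← hV]
  rw [hsymm a]
  ring

end CoordinateVariation

theorem hasDerivWithinAt_fst_apply {E : Type*} [NormedAddCommGroup E] [NormedSpace ℝ E]
    {G : ℝ → E → E →L[ℝ] E →L[ℝ] ℝ} {J : Set ℝ} {U : Set E}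
    (hG : DifferentiableOn ℝ (Function.uncurry G) (J ×ˢ U)) {t : ℝ} (ht : t ∈ J) {y : E}
    (hy : y ∈ U) (u v : E) :
    HasDerivWithinAt (fun s => G s y u v)
      (fderivWithin ℝ (Function.uncurry G) (J ×ˢ U) (t, y) (1, 0) u v) J t := by
  have h1 : HasDerivWithinAt (fun s : ℝ => (s, y)) ((1 : ℝ), (0 : E)) J t :=
    (hasDerivWithinAt_id _ _).prodMk (hasDerivWithinAt_const _ _ _)
  have h2 : HasDerivWithinAt (fun s : ℝ => G s y)
      (fderivWithin ℝ (Function.uncurry G) (J ×ˢ U) (t, y) (1, 0)) J t :=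
    HasFDerivWithinAt.comp_hasDerivWithinAt (t := J ×ˢ U) (l := Function.uncurry G) t
      (hG (t, y) ⟨ht, hy⟩).hasFDerivWithinAt h1 (fun s hs => ⟨hs, hy⟩)
  simpa using (h2.clm_apply (hasDerivWithinAt_const t J u)).clm_apply
    (hasDerivWithinAt_const t J v)

/-! ### First variation on the manifold -/

section ManifoldVariation

variable {n : ℕ} {M : Type*} [TopologicalSpace M] [ChartedSpace (EuclideanSpace ℝ (Fin n)) M]

/-- The left-hand side of the Euler-Lagrange equation. -/
def eulerLagrange (α : ℝ) (J : Set ℝ)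
    (g : ℝ → Bundle.RiemannianMetric (fun x : M => TangentSpace (𝓡 n) x)) (φ : ℝ → M) (t : ℝ) :
    TangentSpace (𝓡 n) (φ t) :=
  covDerivAlong (g t) J φ (velocity J φ) t
    + α • sharp (g t) (φ t) (ricci (g t) (φ t)) (velocity J φ t)
    + ((1 - 3 * α) / 12) • gradient (g t) (scalarCurvature (g t)) (φ t)

/-- The Lagrangian along a family of curves `Φ(s, ·)`. -/
def familyLagrangian (J : Set ℝ)
    (g : ℝ → Bundle.RiemannianMetric (fun x : M => TangentSpace (𝓡 n) x)) (Φ : ℝ → ℝ → M)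
    (q : ℝ × ℝ) : ℝ :=
  lagrangian J g (fun _ _ => 0) q.2 (Φ q.1 q.2) (velocity J (Φ q.1) q.2)

/-- The pairing `⟨∂_t Φ, ∂_s Φ⟩` of the velocity with the variation field. -/
def familyMomentum (I J : Set ℝ)
    (g : ℝ → Bundle.RiemannianMetric (fun x : M => TangentSpace (𝓡 n) x)) (Φ : ℝ → ℝ → M)
    (q : ℝ × ℝ) : ℝ :=
  (g q.2).inner (Φ q.1 q.2) (velocity J (Φ q.1) q.2) (velocity I (fun s => Φ s q.2) q.1)

theorem inner_sharp (g : Bundle.RiemannianMetric (fun x : M => TangentSpace (𝓡 n) x)) (x : M)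
    (A : TangentSpace (𝓡 n) x →L[ℝ] TangentSpace (𝓡 n) x →L[ℝ] ℝ) (v w : TangentSpace (𝓡 n) x) :
    g.inner x (sharp g x A v) w = A v w := by
  have h : g.inner x (sharp g x A v) = A v := (isInvertible_inner g x).self_apply_inverse _
  rw [h]

variable {I J : Set ℝ} {g : ℝ → Bundle.RiemannianMetric (fun x : M => TangentSpace (𝓡 n) x)}
  {Φ : ℝ → ℝ → M} {q : ℝ × ℝ} {p : M}

theorem eventually_mem_source
    (hΦ : ContMDiffOn 𝓘(ℝ, ℝ × ℝ) (𝓡 n) ∞ (fun q : ℝ × ℝ => Φ q.1 q.2) (I ×ˢ J))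
    (hq : q ∈ I ×ˢ J) (hp : Φ q.1 q.2 ∈ (extChartAt (𝓡 n) p).source) :
    ∀ᶠ z in nhdsWithin q (I ×ˢ J), z ∈ I ×ˢ J ∧ Φ z.1 z.2 ∈ (extChartAt (𝓡 n) p).source :=
  Filter.Eventually.and self_mem_nhdsWithin
    ((hΦ q hq).continuousWithinAt.preimage_mem_nhdsWithin
      ((isOpen_extChartAt_source p).mem_nhds hp))

variable [IsManifold (𝓡 n) ∞ M]

theorem dChart_velocity {J : Set ℝ} {γ : ℝ → M} {t : ℝ} {p : M}
    (hγ : MDifferentiableWithinAt 𝓘(ℝ, ℝ) (𝓡 n) γ J t)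
    (hp : γ t ∈ (extChartAt (𝓡 n) p).source) (hJ : UniqueDiffWithinAt ℝ J t) :
    dChart p (γ t) (velocity J γ t) = derivWithin (fun s => extChartAt (𝓡 n) p (γ s)) J t := by
  have h := mfderiv_comp_mfderivWithin t (mdifferentiableAt_chart hp) hγ
    (uniqueMDiffWithinAt_iff_uniqueDiffWithinAt.2 hJ)
  rw [mfderivWithin_eq_fderivWithin] at h
  exact (DFunLike.congr_fun h (1 : ℝ)).symm

theorem contDiffWithinAt_chart_family
    (hΦ : ContMDiffOn 𝓘(ℝ, ℝ × ℝ) (𝓡 n) ∞ (fun q : ℝ × ℝ => Φ q.1 q.2) (I ×ˢ J))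
    (hq : q ∈ I ×ˢ J) (hp : Φ q.1 q.2 ∈ (extChartAt (𝓡 n) p).source) :
    ContDiffWithinAt ℝ ∞ (fun q : ℝ × ℝ => extChartAt (𝓡 n) p (Φ q.1 q.2)) (I ×ˢ J) q := by
  rw [← contMDiffWithinAt_iff_contDiffWithinAt]
  rw [extChartAt_source] at hp
  exact ContMDiffAt.comp_contMDiffWithinAt q (contMDiffAt_extChartAt' hp) (hΦ q hq)

theorem dChart_velocity_snd (hJ : UniqueDiffOn ℝ J)
    (hΦ : ContMDiffOn 𝓘(ℝ, ℝ × ℝ) (𝓡 n) ∞ (fun q : ℝ × ℝ => Φ q.1 q.2) (I ×ˢ J))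
    (hq : q ∈ I ×ˢ J) (hp : Φ q.1 q.2 ∈ (extChartAt (𝓡 n) p).source) :
    dChart p (Φ q.1 q.2) (velocity J (Φ q.1) q.2) =
      fderivWithin ℝ (fun q : ℝ × ℝ => extChartAt (𝓡 n) p (Φ q.1 q.2)) (I ×ˢ J) q (0, 1) := by
  have hγ : MDifferentiableWithinAt 𝓘(ℝ, ℝ) (𝓡 n) (Φ q.1) J q.2 := by
    have h1 : MDifferentiableWithinAt 𝓘(ℝ, ℝ × ℝ) (𝓡 n) (fun q : ℝ × ℝ => Φ q.1 q.2) (I ×ˢ J)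
        (q.1, q.2) := (hΦ q hq).mdifferentiableWithinAt (by simp)
    have h2 : MDifferentiableWithinAt 𝓘(ℝ, ℝ) 𝓘(ℝ, ℝ × ℝ) (fun t : ℝ => (q.1, t)) J q.2 :=
      ((hasDerivWithinAt_const q.2 J q.1).prodMk
        (hasDerivWithinAt_id q.2 J)).differentiableWithinAt.mdifferentiableWithinAt
    exact MDifferentiableWithinAt.comp (u := I ×ˢ J) (f := fun t : ℝ => (q.1, t)) q.2 h1 h2 (fun t ht => ⟨hq.1, ht⟩)
  rw [dChart_velocity hγ hp (hJ q.2 hq.2)]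
  exact (hasDerivWithinAt_snd_slice hq
    ((contDiffWithinAt_chart_family hΦ hq hp).differentiableWithinAt (by simp))).derivWithin
    (hJ q.2 hq.2)

theorem dChart_velocity_fst (hI : IsOpen I)
    (hΦ : ContMDiffOn 𝓘(ℝ, ℝ × ℝ) (𝓡 n) ∞ (fun q : ℝ × ℝ => Φ q.1 q.2) (I ×ˢ J))
    (hq : q ∈ I ×ˢ J) (hp : Φ q.1 q.2 ∈ (extChartAt (𝓡 n) p).source) :
    dChart p (Φ q.1 q.2) (velocity I (fun s => Φ s q.2) q.1) =
      fderivWithin ℝ (fun q : ℝ × ℝ => extChartAt (𝓡 n) p (Φ q.1 q.2)) (I ×ˢ J) q (1, 0) := by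
  have hγ : MDifferentiableWithinAt 𝓘(ℝ, ℝ) (𝓡 n) (fun s => Φ s q.2) I q.1 := by
    have h1 : MDifferentiableWithinAt 𝓘(ℝ, ℝ × ℝ) (𝓡 n) (fun q : ℝ × ℝ => Φ q.1 q.2) (I ×ˢ J)
        (q.1, q.2) := (hΦ q hq).mdifferentiableWithinAt (by simp)
    have h2 : MDifferentiableWithinAt 𝓘(ℝ, ℝ) 𝓘(ℝ, ℝ × ℝ) (fun s : ℝ => (s, q.2)) I q.1 :=
      ((hasDerivWithinAt_id q.1 I).prodMk
        (hasDerivWithinAt_const q.1 I q.2)).differentiableWithinAt.mdifferentiableWithinAt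
    exact MDifferentiableWithinAt.comp (u := I ×ˢ J) (f := fun s : ℝ => (s, q.2)) q.1 h1 h2 (fun t ht => ⟨ht, hq.2⟩)
  rw [dChart_velocity hγ hp (hI.uniqueDiffOn q.1 hq.1)]
  exact (hasDerivWithinAt_fst_slice hq
    ((contDiffWithinAt_chart_family hΦ hq hp).differentiableWithinAt (by simp))).derivWithin
    (hI.uniqueDiffOn q.1 hq.1)

variable {α : ℝ}

/-- Equality at `q` alone would not suffice, since both sides are differentiated. By continuity the
family stays in the fixed chart at `p` near `q`, where the chart-independent expressions apply. -/
theorem familyLagrangian_eventuallyEq (hJ : UniqueDiffOn ℝ J)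
    (hg : IsMetricFamilyOfClass 3 J g) (hflow : IsRicciFlow α J g)
    (hΦ : ContMDiffOn 𝓘(ℝ, ℝ × ℝ) (𝓡 n) ∞ (fun q : ℝ × ℝ => Φ q.1 q.2) (I ×ˢ J))
    (hq : q ∈ I ×ˢ J) (hp : Φ q.1 q.2 ∈ (extChartAt (𝓡 n) p).source) :
    familyLagrangian J g Φ =ᶠ[nhdsWithin q (I ×ˢ J)]
      coordLagrangian I J ((1 - 3 * α) / 12) (fun t => chartMetric (g t) p)
        (fun t => coordScalar (chartMetric (g t) p))
        (fun q : ℝ × ℝ => extChartAt (𝓡 n) p (Φ q.1 q.2)) := by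
  filter_upwards [eventually_mem_source hΦ hq hp] with z hz
  rw [familyLagrangian, lagrangian_eq hJ hflow hz.1.2, inner_eq_chartMetric (g z.2) hz.2,
    scalarCurvature_eq_chart hJ hg hz.1.2 hz.2, dChart_velocity_snd hJ hΦ hz.1 hz.2]
  rfl

theorem familyMomentum_eventuallyEq (hI : IsOpen I) (hJ : UniqueDiffOn ℝ J)
    (hΦ : ContMDiffOn 𝓘(ℝ, ℝ × ℝ) (𝓡 n) ∞ (fun q : ℝ × ℝ => Φ q.1 q.2) (I ×ˢ J))
    (hq : q ∈ I ×ˢ J) (hp : Φ q.1 q.2 ∈ (extChartAt (𝓡 n) p).source) :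
    familyMomentum I J g Φ =ᶠ[nhdsWithin q (I ×ˢ J)]
      coordMomentum I J (fun t => chartMetric (g t) p)
        (fun q : ℝ × ℝ => extChartAt (𝓡 n) p (Φ q.1 q.2)) := by
  filter_upwards [eventually_mem_source hΦ hq hp] with z hz
  rw [familyMomentum, inner_eq_chartMetric (g z.2) hz.2,
    dChart_velocity_snd hJ hΦ hz.1 hz.2, dChart_velocity_fst hI hΦ hz.1 hz.2]
  rfl

theorem contDiffOn_familyLagrangian (hI : IsOpen I) (hJ : UniqueDiffOn ℝ J)
    (hg : IsMetricFamilyOfClass 3 J g) (hflow : IsRicciFlow α J g)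
    (hΦ : ContMDiffOn 𝓘(ℝ, ℝ × ℝ) (𝓡 n) ∞ (fun q : ℝ × ℝ => Φ q.1 q.2) (I ×ˢ J)) :
    ContDiffOn ℝ 1 (familyLagrangian J g Φ) (I ×ˢ J) := by
  intro q hq
  have hp := mem_extChartAt_source (I := 𝓡 n) (Φ q.1 q.2)
  have he := familyLagrangian_eventuallyEq hJ hg hflow hΦ hq hp
  exact (contDiffWithinAt_coordLagrangian _ hI hJ (isOpen_extChartAt_target _)
    ((contDiffOn_chartMetric hg _).of_le (by norm_num)) (contDiffOn_coordScalar_chartMetric hJ hg _)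
    hq (contDiffWithinAt_chart_family hΦ hq hp) (chart_mem_target hp)).congr_of_eventuallyEq he
    (he.eq_of_nhdsWithin hq)

theorem contDiffOn_familyMomentum (hI : IsOpen I) (hJ : UniqueDiffOn ℝ J)
    (hg : IsMetricFamilyOfClass 3 J g)
    (hΦ : ContMDiffOn 𝓘(ℝ, ℝ × ℝ) (𝓡 n) ∞ (fun q : ℝ × ℝ => Φ q.1 q.2) (I ×ˢ J)) :
    ContDiffOn ℝ 1 (familyMomentum I J g Φ) (I ×ˢ J) := by
  intro q hq
  have hp := mem_extChartAt_source (I := 𝓡 n) (Φ q.1 q.2)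
  have he := familyMomentum_eventuallyEq (g := g) hI hJ hΦ hq hp
  exact (contDiffWithinAt_coordMomentum hI hJ (isOpen_extChartAt_target _)
    ((contDiffOn_chartMetric hg _).of_le (by norm_num))
    hq (contDiffWithinAt_chart_family hΦ hq hp) (chart_mem_target hp)).congr_of_eventuallyEq he
    (he.eq_of_nhdsWithin hq)

theorem inner_gradient (g : Bundle.RiemannianMetric (fun x : M => TangentSpace (𝓡 n) x))
    {f : M → ℝ} {F : EuclideanSpace ℝ (Fin n) → ℝ} {x : M}
    (hx : x ∈ (extChartAt (𝓡 n) p).source)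
    (hF : DifferentiableAt ℝ F (extChartAt (𝓡 n) p x))
    (hf : ∀ z ∈ (extChartAt (𝓡 n) p).source, f z = F (extChartAt (𝓡 n) p z))
    (w : TangentSpace (𝓡 n) x) :
    g.inner x (gradient g f x) w = fderiv ℝ F (extChartAt (𝓡 n) p x) (dChart p x w) := by
  have h0 : g.inner x (gradient g f x) = mfderiv (𝓡 n) 𝓘(ℝ, ℝ) f x :=
    (isInvertible_inner g x).self_apply_inverse _
  have h1 := mfderiv_comp x hF.mdifferentiableAt (mdifferentiableAt_chart hx)
  rw [mfderiv_eq_fderiv] at h1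
  have h2 : f =ᶠ[nhds x] F ∘ extChartAt (𝓡 n) p := by
    filter_upwards [(isOpen_extChartAt_source p).mem_nhds hx] with z hz
    exact hf z hz
  rw [h0, h2.mfderiv_eq, h1]
  rfl

theorem inner_gradient_scalarCurvature (hJ : UniqueDiffOn ℝ J)
    (hg : IsMetricFamilyOfClass 3 J g) {t : ℝ} (ht : t ∈ J) {x : M}
    (hx : x ∈ (extChartAt (𝓡 n) p).source) (w : TangentSpace (𝓡 n) x) :
    (g t).inner x (gradient (g t) (scalarCurvature (g t)) x) w =
      fderiv ℝ (coordScalar (chartMetric (g t) p)) (extChartAt (𝓡 n) p x) (dChart p x w) :=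
  inner_gradient (g t) hx
    (((contDiffOn_slice (contDiffOn_coordScalar_chartMetric hJ hg p) ht).differentiableOn
      (by simp)).differentiableAt
      ((isOpen_extChartAt_target p).mem_nhds (chart_mem_target hx)))
    (fun _ hz => scalarCurvature_eq_chart hJ hg ht hz) w

/-- The Ricci flow equation in a chart. -/
theorem ricci_flow_chart (hJ : UniqueDiffOn ℝ J) (hg : IsMetricFamilyOfClass 3 J g)
    (hflow : IsRicciFlow α J g) {t : ℝ} (ht : t ∈ J) {x : M}
    (hx : x ∈ (extChartAt (𝓡 n) p).source) (v w : TangentSpace (𝓡 n) x) :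
    α * ricci (g t) x v w =
      fderivWithin ℝ (Function.uncurry fun t => chartMetric (g t) p)
        (J ×ˢ (extChartAt (𝓡 n) p).target) (t, extChartAt (𝓡 n) p x) (1, 0)
        (dChart p x v) (dChart p x w) := by
  have h4 : HasDerivWithinAt (fun s : ℝ => chartMetric (g s) p (extChartAt (𝓡 n) p x)
      (dChart p x v) (dChart p x w)) (α * ricci (g t) x v w) J t :=
    (hflow t ht x v w).congr (fun s _ => (inner_eq_chartMetric (g s) hx v w).symm)
      (inner_eq_chartMetric (g t) hx v w).symm
  exact (hJ t ht).eq_deriv _ h4 (hasDerivWithinAt_fst_apply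
    ((contDiffOn_chartMetric hg p).differentiableOn (by simp)) ht (chart_mem_target hx)
    (dChart p x v) (dChart p x w))

/-- The first variation formula, before integration. -/
theorem first_variation (hI : IsOpen I) (hJ : UniqueDiffOn ℝ J)
    (hg : IsMetricFamilyOfClass 3 J g) (hflow : IsRicciFlow α J g)
    (hΦ : ContMDiffOn 𝓘(ℝ, ℝ × ℝ) (𝓡 n) ∞ (fun q : ℝ × ℝ => Φ q.1 q.2) (I ×ˢ J))
    (hq : q ∈ I ×ˢ J) (hcl : q ∈ closure (interior (I ×ˢ J))) :
    fderivWithin ℝ (familyMomentum I J g Φ) (I ×ˢ J) q (0, 1)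
        - fderivWithin ℝ (familyLagrangian J g Φ) (I ×ˢ J) q (1, 0) =
      (g q.2).inner (Φ q.1 q.2) (eulerLagrange α J g (Φ q.1) q.2)
        (velocity I (fun s => Φ s q.2) q.1) := by
  set p := Φ q.1 q.2 with hpdef
  have hp : Φ q.1 q.2 ∈ (extChartAt (𝓡 n) p).source := mem_extChartAt_source (I := 𝓡 n) _
  have heL := familyLagrangian_eventuallyEq hJ hg hflow hΦ hq hp
  have heM := familyMomentum_eventuallyEq (g := g) hI hJ hΦ hq hp
  have hc := contDiffWithinAt_chart_family hΦ hq hp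
  rw [heL.fderivWithin_eq (heL.eq_of_nhdsWithin hq), heM.fderivWithin_eq (heM.eq_of_nhdsWithin hq),
    coord_first_variation _ hI hJ (isOpen_extChartAt_target p)
      ((contDiffOn_chartMetric hg p).of_le (by norm_num))
      (contDiffOn_coordScalar_chartMetric hJ hg p) hq hcl hc (chart_mem_target hp)
      (chartMetric_symm (g q.2) p _) (isInvertible_chartMetric (g q.2) (chart_mem_target hp)),
    ← dChart_velocity_snd hJ hΦ hq hp, ← dChart_velocity_fst hI hΦ hq hp,
    ← ricci_flow_chart hJ hg hflow hq.2 hp, ← inner_gradient_scalarCurvature hJ hg hq.2 hp]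
  -- `dChart p p` cancels the inverse in `covDerivAlong`; the remaining derivative of the coordinate
  -- velocity along the `t`-slice is the second partial of the coordinate family.
  have hcov : dChart p p (covDerivAlong (g q.2) J (Φ q.1) (velocity J (Φ q.1)) q.2) =
      fderivWithin ℝ (fun z => fderivWithin ℝ (fun q : ℝ × ℝ => extChartAt (𝓡 n) p (Φ q.1 q.2))
          (I ×ˢ J) z (0, 1)) (I ×ˢ J) q (0, 1)
        + christoffel (chartMetric (g q.2) p) (extChartAt (𝓡 n) p p)
            (dChart p p (velocity J (Φ q.1) q.2)) (dChart p p (velocity J (Φ q.1) q.2)) := by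
    have h1 : dChart p p (covDerivAlong (g q.2) J (Φ q.1) (velocity J (Φ q.1)) q.2) = _ :=
      (isInvertible_dChart hp).self_apply_inverse _
    rw [h1]
    congr 1
    have h2 := hasDerivWithinAt_snd_slice hq
      ((contDiffWithinAt_partial hI hJ hq hc (0, 1)).differentiableWithinAt (by simp))
    have h3 : (fun s : ℝ => dChart p (Φ q.1 s) (velocity J (Φ q.1) s)) =ᶠ[nhdsWithin q.2 J]
        fun s => fderivWithin ℝ (fun q : ℝ × ℝ => extChartAt (𝓡 n) p (Φ q.1 q.2))
          (I ×ˢ J) (q.1, s) (0, 1) := by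
      have h4 : Filter.Tendsto (fun s : ℝ => (q.1, s)) (nhdsWithin q.2 J)
          (nhdsWithin q (I ×ˢ J)) := by
        refine tendsto_nhdsWithin_iff.2 ⟨?_, ?_⟩
        · exact (Continuous.prodMk_right q.1).continuousWithinAt
        · filter_upwards [self_mem_nhdsWithin] with s hs
          exact ⟨hq.1, hs⟩
      filter_upwards [h4.eventually (eventually_mem_source hΦ hq hp)] with s hs
      exact dChart_velocity_snd hJ hΦ hs.1 hs.2
    exact (h2.congr_of_eventuallyEq h3 (h3.eq_of_nhdsWithin hq.2)).derivWithin (hJ q.2 hq.2)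
  rw [← hcov, eulerLagrange]
  simp only [map_add, map_smul, add_apply, smul_apply, smul_eq_mul]
  rw [inner_sharp, ← inner_eq_chartMetric (g q.2) hp]
  ring

end ManifoldVariation

/-! ### Differentiating the energy -/

section Energy

/-- Differentiation under the integral of a function of class `C^1` on a strip. -/
theorem hasDerivAt_integral_of_contDiffOn {f : ℝ × ℝ → ℝ} {a b ε : ℝ} (hab : a < b) (hε : 0 < ε)
    (hf : ContDiffOn ℝ 1 f (Ioo (-ε) ε ×ˢ Icc a b)) :
    HasDerivAt (fun s => ∫ t in a..b, f (s, t))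
      (∫ t in a..b, fderivWithin ℝ f (Ioo (-ε) ε ×ˢ Icc a b) (0, t) (1, 0)) 0 := by
  have hS : UniqueDiffOn ℝ (Ioo (-ε) ε ×ˢ Icc a b) :=
    (uniqueDiffOn_Ioo _ _).prod (uniqueDiffOn_Icc hab)
  have hcont : ContinuousOn (fun q => fderivWithin ℝ f (Ioo (-ε) ε ×ˢ Icc a b) q (1, 0))
      (Ioo (-ε) ε ×ˢ Icc a b) :=
    (hf.continuousOn_fderivWithin hS le_rfl).clm_apply continuousOn_const
  have hslice : ∀ {h : ℝ × ℝ → ℝ}, ContinuousOn h (Ioo (-ε) ε ×ˢ Icc a b) → ∀ s ∈ Ioo (-ε) ε,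
      ContinuousOn (fun t => h (s, t)) (Icc a b) := fun hh s hs =>
    hh.comp (Continuous.prodMk_right s).continuousOn (fun t ht => ⟨hs, ht⟩)
  have hmeas : ∀ {h : ℝ → ℝ}, ContinuousOn h (Icc a b) →
      MeasureTheory.AEStronglyMeasurable h (MeasureTheory.volume.restrict (uIoc a b)) := by
    intro h hh
    rw [uIoc_of_le hab.le]
    exact (hh.mono Ioc_subset_Icc_self).aestronglyMeasurable measurableSet_Ioc
  have h0 : (0 : ℝ) ∈ Ioo (-ε) ε := ⟨by linarith, hε⟩
  -- Halving the parameter interval makes the strip compact, so that a constant dominates the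
  -- derivative.
  have hsub : Icc (-(ε / 2)) (ε / 2) ⊆ Ioo (-ε) ε := fun s hs =>
    ⟨by linarith [hs.1], by linarith [hs.2]⟩
  obtain ⟨C, hC⟩ := (isCompact_Icc.prod isCompact_Icc).exists_bound_of_continuousOn
    (hcont.mono (prod_mono hsub (Subset.refl (Icc a b))))
  refine (intervalIntegral.hasDerivAt_integral_of_dominated_loc_of_deriv_le
    (F := fun s t => f (s, t))
    (F' := fun s t => fderivWithin ℝ f (Ioo (-ε) ε ×ˢ Icc a b) (s, t) (1, 0))
    (s := Icc (-(ε / 2)) (ε / 2)) (bound := fun _ => C)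
    (Icc_mem_nhds (by linarith) (by linarith)) ?_ ?_ (hmeas (hslice hcont 0 h0)) ?_ ?_ ?_).2
  · filter_upwards [isOpen_Ioo.mem_nhds h0] with s hs
    exact hmeas (hslice hf.continuousOn s hs)
  · exact (hslice hf.continuousOn 0 h0).intervalIntegrable_of_Icc hab.le
  · refine Filter.Eventually.of_forall fun t ht s hs => hC (s, t) ⟨hs, ?_⟩
    rw [uIoc_of_le hab.le] at ht
    exact Ioc_subset_Icc_self ht
  · exact intervalIntegrable_const
  · refine Filter.Eventually.of_forall fun t ht s hs => ?_
    rw [uIoc_of_le hab.le] at ht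
    have hq : (s, t) ∈ Ioo (-ε) ε ×ˢ Icc a b := ⟨hsub hs, Ioc_subset_Icc_self ht⟩
    exact (hasDerivWithinAt_fst_slice hq (hf.differentiableOn (by simp) _ hq)).hasDerivAt
      (isOpen_Ioo.mem_nhds hq.1)

/-- Supplies the condition for symmetry of second derivatives, in particular on the edges `t = a`
and `t = b`. -/
theorem mem_closure_interior_strip {a b ε : ℝ} (hab : a < b) {q : ℝ × ℝ}
    (hq : q ∈ Ioo (-ε) ε ×ˢ Icc a b) : q ∈ closure (interior (Ioo (-ε) ε ×ˢ Icc a b)) := by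
  rw [interior_prod_eq, closure_prod_eq, interior_Icc, closure_Ioo hab.ne, interior_Ioo]
  exact ⟨subset_closure hq.1, hq.2⟩

variable {n : ℕ} {M : Type*} [TopologicalSpace M] [ChartedSpace (EuclideanSpace ℝ (Fin n)) M]
  [IsManifold (𝓡 n) ∞ M]
  {T ε α : ℝ} {g : ℝ → Bundle.RiemannianMetric (fun x : M => TangentSpace (𝓡 n) x)}
  {Φ : ℝ → ℝ → M}

theorem inner_eulerLagrange_eq (hT : 0 < T) (hε : 0 < ε)
    (hg : IsMetricFamilyOfClass 3 (Icc 0 T) g) (hflow : IsRicciFlow α (Icc 0 T) g)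
    (hΦ : ContMDiffOn 𝓘(ℝ, ℝ × ℝ) (𝓡 n) ∞ (fun q : ℝ × ℝ => Φ q.1 q.2)
      (Ioo (-ε) ε ×ˢ Icc 0 T)) {t : ℝ} (ht : t ∈ Icc 0 T) :
    (g t).inner (Φ 0 t) (eulerLagrange α (Icc 0 T) g (Φ 0) t)
        (velocity (Ioo (-ε) ε) (fun s => Φ s t) 0) =
      fderivWithin ℝ (familyMomentum (Ioo (-ε) ε) (Icc 0 T) g Φ) (Ioo (-ε) ε ×ˢ Icc 0 T)
          (0, t) (0, 1)
        - fderivWithin ℝ (familyLagrangian (Icc 0 T) g Φ) (Ioo (-ε) ε ×ˢ Icc 0 T) (0, t) (1, 0) :=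
  have hq : ((0 : ℝ), t) ∈ Ioo (-ε) ε ×ˢ Icc 0 T := ⟨⟨by linarith, hε⟩, ht⟩
  (first_variation (q := (0, t)) isOpen_Ioo (uniqueDiffOn_Icc hT) hg hflow hΦ hq
    (mem_closure_interior_strip hT hq)).symm

/-- Continuity is read off the other side of the first variation formula, which is built from first
derivatives of `C^1` functions. This avoids following `eulerLagrange` through moving charts. -/
theorem continuousOn_inner_eulerLagrange (hT : 0 < T) (hε : 0 < ε)
    (hg : IsMetricFamilyOfClass 3 (Icc 0 T) g) (hflow : IsRicciFlow α (Icc 0 T) g)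
    (hΦ : ContMDiffOn 𝓘(ℝ, ℝ × ℝ) (𝓡 n) ∞ (fun q : ℝ × ℝ => Φ q.1 q.2)
      (Ioo (-ε) ε ×ˢ Icc 0 T)) :
    ContinuousOn (fun t => (g t).inner (Φ 0 t) (eulerLagrange α (Icc 0 T) g (Φ 0) t)
        (velocity (Ioo (-ε) ε) (fun s => Φ s t) 0)) (Icc 0 T) := by
  have hJ := uniqueDiffOn_Icc hT
  have hS := (uniqueDiffOn_Ioo (-ε) ε).prod hJ
  have hL := contDiffOn_familyLagrangian isOpen_Ioo hJ hg hflow hΦ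
  have hM := contDiffOn_familyMomentum isOpen_Ioo hJ hg hΦ
  have hc : ContinuousOn (fun t : ℝ => ((0 : ℝ), t)) (Icc 0 T) :=
    (Continuous.prodMk_right 0).continuousOn
  have hm : MapsTo (fun t : ℝ => ((0 : ℝ), t)) (Icc 0 T) (Ioo (-ε) ε ×ˢ Icc 0 T) :=
    fun t ht => ⟨⟨by linarith, hε⟩, ht⟩
  refine ContinuousOn.congr ?_ fun t ht => inner_eulerLagrange_eq hT hε hg hflow hΦ ht
  exact ((((hM.continuousOn_fderivWithin hS le_rfl).comp hc hm).clm_apply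
    continuousOn_const).sub
    (((hL.continuousOn_fderivWithin hS le_rfl).comp hc hm).clm_apply continuousOn_const))

/-- The first variation of the energy. -/
theorem hasDerivAt_energy (hT : 0 < T) (hε : 0 < ε)
    (hg : IsMetricFamilyOfClass 3 (Icc 0 T) g) (hflow : IsRicciFlow α (Icc 0 T) g)
    (hΦ : ContMDiffOn 𝓘(ℝ, ℝ × ℝ) (𝓡 n) ∞ (fun q : ℝ × ℝ => Φ q.1 q.2)
      (Ioo (-ε) ε ×ˢ Icc 0 T)) :
    HasDerivAt (fun s => energy T g (fun _ _ => 0) (Φ s))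
      (familyMomentum (Ioo (-ε) ε) (Icc 0 T) g Φ (0, T)
        - familyMomentum (Ioo (-ε) ε) (Icc 0 T) g Φ (0, 0)
        - ∫ t in (0 : ℝ)..T, (g t).inner (Φ 0 t) (eulerLagrange α (Icc 0 T) g (Φ 0) t)
            (velocity (Ioo (-ε) ε) (fun s => Φ s t) 0)) 0 := by
  have hJ := uniqueDiffOn_Icc hT
  have hS := (uniqueDiffOn_Ioo (-ε) ε).prod hJ
  have hL := contDiffOn_familyLagrangian isOpen_Ioo hJ hg hflow hΦ
  have hM := contDiffOn_familyMomentum isOpen_Ioo hJ hg hΦ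
  have hc : ContinuousOn (fun t : ℝ => ((0 : ℝ), t)) (Icc 0 T) :=
    (Continuous.prodMk_right 0).continuousOn
  have hm : MapsTo (fun t : ℝ => ((0 : ℝ), t)) (Icc 0 T) (Ioo (-ε) ε ×ˢ Icc 0 T) :=
    fun t ht => ⟨⟨by linarith, hε⟩, ht⟩
  have hdM : ContinuousOn (fun t : ℝ => fderivWithin ℝ
      (familyMomentum (Ioo (-ε) ε) (Icc 0 T) g Φ) (Ioo (-ε) ε ×ˢ Icc 0 T) (0, t) (0, 1))
      (Icc 0 T) :=
    ((hM.continuousOn_fderivWithin hS le_rfl).comp hc hm).clm_apply continuousOn_const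
  -- The total `t`-derivative integrates to the boundary values of the momentum pairing.
  have hftc : ∫ t in (0 : ℝ)..T, fderivWithin ℝ
      (familyMomentum (Ioo (-ε) ε) (Icc 0 T) g Φ) (Ioo (-ε) ε ×ˢ Icc 0 T) (0, t) (0, 1) =
      familyMomentum (Ioo (-ε) ε) (Icc 0 T) g Φ (0, T)
        - familyMomentum (Ioo (-ε) ε) (Icc 0 T) g Φ (0, 0) := by
    refine intervalIntegral.integral_eq_sub_of_hasDerivAt_of_le
      (f := fun t => familyMomentum (Ioo (-ε) ε) (Icc 0 T) g Φ (0, t)) hT.le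
      (hM.continuousOn.comp hc hm) (fun t ht => ?_) (hdM.intervalIntegrable_of_Icc hT.le)
    have hq := hm (Ioo_subset_Icc_self ht)
    exact (hasDerivWithinAt_snd_slice hq (hM.differentiableOn (by simp) _ hq)).hasDerivAt
      (Icc_mem_nhds ht.1 ht.2)
  have hP := continuousOn_inner_eulerLagrange hT hε hg hflow hΦ
  have key : ∫ t in (0 : ℝ)..T, fderivWithin ℝ (familyLagrangian (Icc 0 T) g Φ)
      (Ioo (-ε) ε ×ˢ Icc 0 T) (0, t) (1, 0) =
      familyMomentum (Ioo (-ε) ε) (Icc 0 T) g Φ (0, T)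
        - familyMomentum (Ioo (-ε) ε) (Icc 0 T) g Φ (0, 0)
        - ∫ t in (0 : ℝ)..T, (g t).inner (Φ 0 t) (eulerLagrange α (Icc 0 T) g (Φ 0) t)
            (velocity (Ioo (-ε) ε) (fun s => Φ s t) 0) := by
    rw [← hftc, ← intervalIntegral.integral_sub (hdM.intervalIntegrable_of_Icc hT.le)
      (hP.intervalIntegrable_of_Icc hT.le)]
    refine intervalIntegral.integral_congr fun t ht => ?_
    rw [uIcc_of_le hT.le] at ht
    simp only [inner_eulerLagrange_eq hT hε hg hflow hΦ ht]
    ring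
  rw [← key]
  exact hasDerivAt_integral_of_contDiffOn hT hε hL

omit [IsManifold (𝓡 n) ∞ M] in
theorem velocity_eq_zero {I : Set ℝ} {γ : ℝ → M} {x : M} {s : ℝ} (hI : UniqueDiffWithinAt ℝ I s)
    (hs : s ∈ I) (hγ : ∀ r ∈ I, γ r = x) : velocity (n := n) I γ s = 0 := by
  have h : HasMFDerivWithinAt 𝓘(ℝ, ℝ) (𝓡 n) γ I s
      (0 : TangentSpace 𝓘(ℝ, ℝ) s →L[ℝ] TangentSpace (𝓡 n) x) :=
    (hasMFDerivWithinAt_const (I := 𝓘(ℝ, ℝ)) (I' := 𝓡 n) x I s).congr_mono hγ (hγ s hs)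
      (Subset.refl I)
  have h1 := h.mfderivWithin (uniqueMDiffWithinAt_iff_uniqueDiffWithinAt.2 hI)
  exact DFunLike.congr_fun h1 (1 : ℝ)

/-- The first variation of the energy for fixed end points. -/
theorem hasDerivAt_energy_of_fixed (hT : 0 < T) (hε : 0 < ε)
    (hg : IsMetricFamilyOfClass 3 (Icc 0 T) g) (hflow : IsRicciFlow α (Icc 0 T) g)
    (hΦ : ContMDiffOn 𝓘(ℝ, ℝ × ℝ) (𝓡 n) ∞ (fun q : ℝ × ℝ => Φ q.1 q.2)
      (Ioo (-ε) ε ×ˢ Icc 0 T))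
    (hfix : ∀ s ∈ Ioo (-ε) ε, Φ s 0 = Φ 0 0 ∧ Φ s T = Φ 0 T) :
    HasDerivAt (fun s => energy T g (fun _ _ => 0) (Φ s))
      (-∫ t in (0 : ℝ)..T, (g t).inner (Φ 0 t) (eulerLagrange α (Icc 0 T) g (Φ 0) t)
            (velocity (Ioo (-ε) ε) (fun s => Φ s t) 0)) 0 := by
  have h := hasDerivAt_energy hT hε hg hflow hΦ
  have h0 : (0 : ℝ) ∈ Ioo (-ε) ε := ⟨by linarith, hε⟩
  have hu := uniqueDiffOn_Ioo (-ε) ε 0 h0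
  have h1 : familyMomentum (Ioo (-ε) ε) (Icc 0 T) g Φ (0, T) = 0 := by
    rw [familyMomentum]
    simp only [velocity_eq_zero (n := n) (γ := fun s => Φ s T) hu h0 fun s hs => (hfix s hs).2,
      map_zero]
  have h2 : familyMomentum (Ioo (-ε) ε) (Icc 0 T) g Φ (0, 0) = 0 := by
    rw [familyMomentum]
    simp only [velocity_eq_zero (n := n) (γ := fun s => Φ s 0) hu h0 fun s hs => (hfix s hs).1,
      map_zero]
  rwa [h1, h2, sub_zero, zero_sub] at h

omit [IsManifold (𝓡 n) ∞ M] in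
theorem energy_congr (hT : 0 ≤ T) {Z : ℝ → ∀ x : M, TangentSpace (𝓡 n) x} {φ ψ : ℝ → M}
    (h : ∀ t ∈ Icc 0 T, φ t = ψ t) : energy T g Z φ = energy T g Z ψ := by
  refine intervalIntegral.integral_congr fun t ht => ?_
  rw [uIcc_of_le hT] at ht
  have key : ∀ (x y : M) (_ : x = y) (v : TangentSpace (𝓡 n) x) (w : TangentSpace (𝓡 n) y),
      (v : EuclideanSpace ℝ (Fin n)) = w →
      lagrangian (Icc 0 T) g Z t x v = lagrangian (Icc 0 T) g Z t y w := by
    rintro x y rfl v w rfl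
    rfl
  refine key _ _ (h t ht) _ _ ?_
  exact DFunLike.congr_fun (mfderivWithin_congr (I := 𝓘(ℝ, ℝ)) (I' := 𝓡 n) (f₁ := φ) (f := ψ)
    (s := Icc 0 T) (x := t) h (h t ht)) (1 : ℝ)

end Energy

/-! ### Localised variations and the fundamental lemma -/

section Criticality

variable {n : ℕ} {M : Type*} [TopologicalSpace M] [ChartedSpace (EuclideanSpace ℝ (Fin n)) M]

/-- The variation of a curve `φ` in the direction `χ(t) ξ` in the chart centred at `p`, for times
in `N`. -/
def chartVariation (φ : ℝ → M) (p : M) (N : Set ℝ) (χ : ℝ → ℝ) (ξ : EuclideanSpace ℝ (Fin n))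
    (s t : ℝ) : M :=
  open Classical in
  if t ∈ N then (extChartAt (𝓡 n) p).symm (extChartAt (𝓡 n) p (φ t) + (s * χ t) • ξ) else φ t

variable {φ : ℝ → M} {p : M} {J O : Set ℝ} {χ : ℝ → ℝ} {ξ : EuclideanSpace ℝ (Fin n)}

theorem chartVariation_of_eq_zero (hO : ∀ t ∈ J ∩ O, φ t ∈ (extChartAt (𝓡 n) p).source)
    {s t : ℝ} (h : s * χ t = 0) : chartVariation φ p (J ∩ O) χ ξ s t = φ t := by
  unfold chartVariation
  split_ifs with ht
  · rw [h, zero_smul, add_zero, (extChartAt (𝓡 n) p).left_inv (hO t ht)]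
  · rfl

theorem exists_chartVariation_mem_target (hJ : IsCompact J) (hφ : ContinuousOn φ J)
    (hO : ∀ t ∈ J ∩ O, φ t ∈ (extChartAt (𝓡 n) p).source) (hχ : Continuous χ)
    (hχc : HasCompactSupport χ) (hχO : tsupport χ ⊆ O) :
    ∃ ε > 0, ∀ s ∈ Ioo (-ε) ε, ∀ t ∈ J ∩ O,
      extChartAt (𝓡 n) p (φ t) + (s * χ t) • ξ ∈ (extChartAt (𝓡 n) p).target := by
  have hK : IsCompact ((fun t => extChartAt (𝓡 n) p (φ t)) '' (J ∩ tsupport χ)) := by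
    refine (hJ.inter_right (isClosed_tsupport χ)).image_of_continuousOn ?_
    exact (continuousOn_extChartAt p).comp (hφ.mono inter_subset_left)
      (fun t ht => hO t ⟨ht.1, hχO ht.2⟩)
  obtain ⟨r, hr, hrK⟩ := hK.exists_thickening_subset_open (isOpen_extChartAt_target (I := 𝓡 n) p)
    (by
      rintro _ ⟨t, ht, rfl⟩
      exact chart_mem_target (hO t ⟨ht.1, hχO ht.2⟩))
  obtain ⟨C, hC⟩ := hχc.exists_bound_of_continuous hχ
  have hC0 : 0 ≤ C := (norm_nonneg _).trans (hC 0)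
  have hpos : 0 < C * ‖ξ‖ + 1 := by positivity
  -- With `|χ| ≤ C` the displacement is at most `|s| C ‖ξ‖ < r`; the `+ 1` keeps the denominator
  -- positive.
  refine ⟨r / (C * ‖ξ‖ + 1), by positivity, fun s hs t ht => ?_⟩
  by_cases htχ : t ∈ tsupport χ
  · apply hrK
    rw [Metric.mem_thickening_iff]
    refine ⟨_, ⟨t, ⟨ht.1, htχ⟩, rfl⟩, ?_⟩
    rw [dist_eq_norm, add_sub_cancel_left, norm_smul, norm_mul, mul_assoc]
    have hs' : ‖s‖ < r / (C * ‖ξ‖ + 1) := by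
      rw [Real.norm_eq_abs, abs_lt]; exact hs
    calc ‖s‖ * (‖χ t‖ * ‖ξ‖) ≤ ‖s‖ * (C * ‖ξ‖ + 1) := by
          have := hC t
          gcongr
          linarith [mul_le_mul_of_nonneg_right this (norm_nonneg ξ)]
      _ < r / (C * ‖ξ‖ + 1) * (C * ‖ξ‖ + 1) := by gcongr
      _ = r := by field_simp
  · rw [image_eq_zero_of_notMem_tsupport htχ, mul_zero, zero_smul, add_zero]
    exact chart_mem_target (hO t ht)

variable [IsManifold (𝓡 n) ∞ M]

/-- Smoothness is local in `t`: on `O` the chart formula applies, off `tsupport χ` the variation is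
constant in `s`, and these two open sets cover the line. -/
theorem contMDiffOn_chartVariation {I : Set ℝ} (hφ : ContMDiffOn 𝓘(ℝ, ℝ) (𝓡 n) ∞ φ J)
    (hOo : IsOpen O) (hO : ∀ t ∈ J ∩ O, φ t ∈ (extChartAt (𝓡 n) p).source)
    (hχ : ContDiff ℝ ∞ χ) (hχO : tsupport χ ⊆ O)
    (ht : ∀ s ∈ I, ∀ t ∈ J ∩ O,
      extChartAt (𝓡 n) p (φ t) + (s * χ t) • ξ ∈ (extChartAt (𝓡 n) p).target) :
    ContMDiffOn 𝓘(ℝ, ℝ × ℝ) (𝓡 n) ∞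
      (fun q : ℝ × ℝ => chartVariation φ p (J ∩ O) χ ξ q.1 q.2) (I ×ˢ J) := by
  have hφ2 : ContMDiffOn 𝓘(ℝ, ℝ × ℝ) (𝓡 n) ∞ (fun q : ℝ × ℝ => φ q.2) (I ×ˢ J) :=
    hφ.comp contDiff_snd.contMDiff.contMDiffOn (fun q hq => hq.2)
  intro q hq
  by_cases hqO : q.2 ∈ O
  · have hmem : I ×ˢ J ∩ Prod.snd ⁻¹' O ∈ nhdsWithin q (I ×ˢ J) :=
      Filter.inter_mem self_mem_nhdsWithin
        (mem_nhdsWithin_of_mem_nhds ((hOo.preimage continuous_snd).mem_nhds hqO))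
    have h1 : ContMDiffOn 𝓘(ℝ, ℝ × ℝ) 𝓘(ℝ, EuclideanSpace ℝ (Fin n)) ∞
        (fun q : ℝ × ℝ => extChartAt (𝓡 n) p (φ q.2)) (I ×ˢ J ∩ Prod.snd ⁻¹' O) := by
      refine ContMDiffOn.comp (t := (extChartAt (𝓡 n) p).source) ?_
        (hφ2.mono inter_subset_left) (fun z hz => hO _ ⟨hz.1.2, hz.2⟩)
      rw [extChartAt_source]
      exact contMDiffOn_extChartAt
    have h2 : ContMDiffOn 𝓘(ℝ, ℝ × ℝ) 𝓘(ℝ, EuclideanSpace ℝ (Fin n)) ∞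
        (fun q : ℝ × ℝ => extChartAt (𝓡 n) p (φ q.2) + (q.1 * χ q.2) • ξ)
        (I ×ˢ J ∩ Prod.snd ⁻¹' O) := by
      rw [contMDiffOn_iff_contDiffOn] at h1 ⊢
      exact h1.add ((contDiff_fst.mul (hχ.comp contDiff_snd)).smul contDiff_const).contDiffOn
    have h3 := (contMDiffOn_extChartAt_symm (I := 𝓡 n) (n := ∞) p).comp h2
      (fun z hz => ht z.1 hz.1.1 z.2 ⟨hz.1.2, hz.2⟩)
    refine (ContMDiffWithinAt.congr (h3 q ⟨hq, hqO⟩) (fun z hz => ?_) ?_).mono_of_mem_nhdsWithin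
      hmem
    · exact if_pos ⟨hz.1.2, hz.2⟩
    · exact if_pos ⟨hq.2, hqO⟩
  · have hqχ : q.2 ∉ tsupport χ := fun h => hqO (hχO h)
    refine (hφ2 q hq).congr_of_eventuallyEq ?_ ?_
    · have hn : Prod.snd ⁻¹' (tsupport χ)ᶜ ∈ nhds q :=
        ((isClosed_tsupport χ).isOpen_compl.preimage continuous_snd).mem_nhds hqχ
      filter_upwards [mem_nhdsWithin_of_mem_nhds hn] with z hz
      exact chartVariation_of_eq_zero hO
        (by rw [image_eq_zero_of_notMem_tsupport hz, mul_zero])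
    · exact chartVariation_of_eq_zero hO
        (by rw [image_eq_zero_of_notMem_tsupport hqχ, mul_zero])

theorem dChart_velocity_chartVariation {ε : ℝ} (hε : 0 < ε)
    (hΦ : ContMDiffOn 𝓘(ℝ, ℝ × ℝ) (𝓡 n) ∞
      (fun q : ℝ × ℝ => chartVariation φ p (J ∩ O) χ ξ q.1 q.2) (Ioo (-ε) ε ×ˢ J))
    (hO : ∀ t ∈ J ∩ O, φ t ∈ (extChartAt (𝓡 n) p).source)
    (htgt : ∀ s ∈ Ioo (-ε) ε, ∀ t ∈ J ∩ O,
      extChartAt (𝓡 n) p (φ t) + (s * χ t) • ξ ∈ (extChartAt (𝓡 n) p).target)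
    {t : ℝ} (ht : t ∈ J ∩ O) :
    dChart p (chartVariation φ p (J ∩ O) χ ξ 0 t)
      (velocity (Ioo (-ε) ε) (fun s => chartVariation φ p (J ∩ O) χ ξ s t) 0) = χ t • ξ := by
  have h0 : (0 : ℝ) ∈ Ioo (-ε) ε := ⟨by linarith, hε⟩
  have hval : ∀ s ∈ Ioo (-ε) ε, extChartAt (𝓡 n) p (chartVariation φ p (J ∩ O) χ ξ s t) =
      extChartAt (𝓡 n) p (φ t) + (s * χ t) • ξ := by
    intro s hs
    rw [chartVariation, if_pos ht, (extChartAt (𝓡 n) p).right_inv (htgt s hs t ht)]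
  have hsrc : chartVariation φ p (J ∩ O) χ ξ 0 t ∈ (extChartAt (𝓡 n) p).source := by
    rw [chartVariation_of_eq_zero hO (zero_mul _)]
    exact hO t ht
  have hγ : MDifferentiableWithinAt 𝓘(ℝ, ℝ) (𝓡 n)
      (fun s => chartVariation φ p (J ∩ O) χ ξ s t) (Ioo (-ε) ε) 0 := by
    have h1 : MDifferentiableWithinAt 𝓘(ℝ, ℝ × ℝ) (𝓡 n)
        (fun q : ℝ × ℝ => chartVariation φ p (J ∩ O) χ ξ q.1 q.2) (Ioo (-ε) ε ×ˢ J) (0, t) :=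
      (hΦ (0, t) ⟨h0, ht.1⟩).mdifferentiableWithinAt (by simp)
    have h2 : MDifferentiableWithinAt 𝓘(ℝ, ℝ) 𝓘(ℝ, ℝ × ℝ) (fun s : ℝ => (s, t)) (Ioo (-ε) ε) 0 :=
      ((hasDerivWithinAt_id (0 : ℝ) (Ioo (-ε) ε)).prodMk
        (hasDerivWithinAt_const (0 : ℝ) (Ioo (-ε) ε)
          t)).differentiableWithinAt.mdifferentiableWithinAt
    exact MDifferentiableWithinAt.comp (u := Ioo (-ε) ε ×ˢ J) (f := fun s : ℝ => (s, t)) 0 h1 h2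
      (fun s hs => ⟨hs, ht.1⟩)
  have hu := uniqueDiffOn_Ioo (-ε) ε 0 h0
  rw [dChart_velocity hγ hsrc hu]
  have hd : HasDerivWithinAt (fun s : ℝ => extChartAt (𝓡 n) p (φ t) + (s * χ t) • ξ)
      (χ t • ξ) (Ioo (-ε) ε) 0 := by
    simpa using ((((hasDerivWithinAt_id (0 : ℝ) (Ioo (-ε) ε)).mul_const (χ t)).smul_const
      ξ).const_add (extChartAt (𝓡 n) p (φ t)))
  exact (hd.congr hval (hval 0 h0)).derivWithin hu

/-- The component in the direction `ξ`, in the chart centred at `p`, of the Euler-Lagrange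
covector. -/
def eulerLagrangeComponent (α T : ℝ)
    (g : ℝ → Bundle.RiemannianMetric (fun x : M => TangentSpace (𝓡 n) x)) (φ : ℝ → M) (p : M)
    (ξ : EuclideanSpace ℝ (Fin n)) (t : ℝ) : ℝ :=
  chartMetric (g t) p (extChartAt (𝓡 n) p (φ t))
    (dChart p (φ t) (eulerLagrange α (Icc 0 T) g φ t)) ξ

variable {T α : ℝ} {g : ℝ → Bundle.RiemannianMetric (fun x : M => TangentSpace (𝓡 n) x)}

/-- Testing the first variation of the energy with chart variations. -/
theorem exists_variation
    (hφ : ContMDiffOn 𝓘(ℝ, ℝ) (𝓡 n) ∞ φ (Icc 0 T)) (hOo : IsOpen O)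
    (hO : ∀ t ∈ Icc 0 T ∩ O, φ t ∈ (extChartAt (𝓡 n) p).source)
    (hχ : ContDiff ℝ ∞ χ) (hχc : HasCompactSupport χ) (hχO : tsupport χ ⊆ O) :
    ∃ ε > 0, ∃ Φ : ℝ → ℝ → M, Φ 0 = φ ∧
      ContMDiffOn 𝓘(ℝ, ℝ × ℝ) (𝓡 n) ∞ (fun q : ℝ × ℝ => Φ q.1 q.2) (Ioo (-ε) ε ×ˢ Icc 0 T) ∧
      (∀ s t, χ t = 0 → Φ s t = φ t) ∧
      ∀ t ∈ Icc 0 T, (g t).inner (Φ 0 t) (eulerLagrange α (Icc 0 T) g (Φ 0) t)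
        (velocity (Ioo (-ε) ε) (fun s => Φ s t) 0) =
          χ t * eulerLagrangeComponent α T g φ p ξ t := by
  obtain ⟨ε, hε, htgt⟩ := exists_chartVariation_mem_target (ξ := ξ) isCompact_Icc hφ.continuousOn
    hO hχ.continuous hχc hχO
  have hΦ := contMDiffOn_chartVariation hφ hOo hO hχ hχO htgt
  have hzero : ∀ s t, χ t = 0 → chartVariation φ p (Icc 0 T ∩ O) χ ξ s t = φ t :=
    fun s t h => chartVariation_of_eq_zero hO (by rw [h, mul_zero])
  have hφ0 : chartVariation φ p (Icc 0 T ∩ O) χ ξ 0 = φ :=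
    funext fun t => chartVariation_of_eq_zero hO (zero_mul _)
  refine ⟨ε, hε, chartVariation φ p (Icc 0 T ∩ O) χ ξ, hφ0, hΦ, hzero, fun t ht => ?_⟩
  by_cases htO : t ∈ O
  · have hv := dChart_velocity_chartVariation hε hΦ hO htgt ⟨ht, htO⟩
    have hsrc : chartVariation φ p (Icc 0 T ∩ O) χ ξ 0 t ∈ (extChartAt (𝓡 n) p).source := by
      rw [hφ0]
      exact hO t ⟨ht, htO⟩
    rw [inner_eq_chartMetric (g t) hsrc, hv, map_smul, hφ0, smul_eq_mul]
    rfl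
  · have hχt : χ t = 0 := image_eq_zero_of_notMem_tsupport fun h => htO (hχO h)
    have h0 : (0 : ℝ) ∈ Ioo (-ε) ε := ⟨by linarith, hε⟩
    rw [velocity_eq_zero (n := n) (γ := fun s => chartVariation φ p (Icc 0 T ∩ O) χ ξ s t)
      (uniqueDiffOn_Ioo (-ε) ε 0 h0) h0 (fun s _ => hzero s t hχt), map_zero, hχt, zero_mul]

/-- Criticality makes the integral of `χ F` vanish for every test function `χ` supported in a small
set `V` of interior times. Hence `F = 0` almost everywhere on `V`, then on all of `V` by continuity,
then at `t₀` by passing to the closure. -/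
theorem eulerLagrangeComponent_eq_zero (hT : 0 < T)
    (hg : IsMetricFamilyOfClass 3 (Icc 0 T) g) (hflow : IsRicciFlow α (Icc 0 T) g)
    (hφ : ContMDiffOn 𝓘(ℝ, ℝ) (𝓡 n) ∞ φ (Icc 0 T))
    (hcrit : IsCriticalCurve n T (energy T g (fun _ _ => 0)) φ) {t₀ : ℝ} (ht₀ : t₀ ∈ Icc 0 T)
    (ξ : EuclideanSpace ℝ (Fin n)) :
    eulerLagrangeComponent α T g φ (φ t₀) ξ t₀ = 0 := by
  set p := φ t₀ with hp
  obtain ⟨δ, hδ, hball⟩ : ∃ δ > 0, ∀ t ∈ Icc 0 T ∩ Metric.ball t₀ δ,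
      φ t ∈ (extChartAt (𝓡 n) p).source := by
    have h := (hφ.continuousOn t₀ ht₀).preimage_mem_nhdsWithin
      ((isOpen_extChartAt_source (I := 𝓡 n) p).mem_nhds (mem_extChartAt_source p))
    obtain ⟨δ, hδ, h⟩ := Metric.mem_nhdsWithin_iff.1 h
    exact ⟨δ, hδ, fun t ht => h ⟨ht.2, ht.1⟩⟩
  set F := eulerLagrangeComponent α T g φ p ξ with hF
  -- continuity near `t₀`
  have hcont : ContinuousOn F (Icc 0 T ∩ Metric.ball t₀ (δ / 3)) := by
    -- The bump is `1` on the `δ/3`-ball and supported inside the `δ`-ball, so on the smaller ball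
    -- `F` is the pairing for an actual variation, known to be continuous.
    let b : ContDiffBump t₀ := ⟨δ / 3, δ / 2, by positivity, by linarith⟩
    obtain ⟨ε, hε, Φ, -, hΦ, -, hP⟩ := exists_variation (α := α) (g := g) (ξ := ξ) (χ := b) hφ
      Metric.isOpen_ball hball b.contDiff b.hasCompactSupport (by
        rw [b.tsupport_eq]
        exact Metric.closedBall_subset_ball (by change δ / 2 < δ; linarith))
    refine ((continuousOn_inner_eulerLagrange hT hε hg hflow hΦ).mono inter_subset_left).congr
      fun t ht => ?_
    refine Eq.trans ?_ (hP t ht.1).symm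
    rw [b.one_of_mem_closedBall (Metric.ball_subset_closedBall ht.2), one_mul]
  -- Removing the end times forces test functions to vanish at `0` and `T`, so that the variations
  -- have fixed end points.
  set V := Metric.ball t₀ (δ / 3) ∩ Ioo 0 T with hV
  have hVo : IsOpen V := Metric.isOpen_ball.inter isOpen_Ioo
  have hVsub : V ⊆ Icc 0 T ∩ Metric.ball t₀ (δ / 3) := fun t ht =>
    ⟨Ioo_subset_Icc_self ht.2, ht.1⟩
  have hae : ∀ᵐ t ∂(MeasureTheory.volume : MeasureTheory.Measure ℝ), t ∈ V → F t = 0 := by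
    refine hVo.ae_eq_zero_of_integral_contDiff_smul_eq_zero
      ((hcont.mono hVsub).locallyIntegrableOn hVo.measurableSet) fun χ hχ hχc hχV => ?_
    obtain ⟨ε, hε, Φ, hΦ0, hΦ, hzero, hP⟩ := exists_variation (α := α) (g := g) (ξ := ξ) hφ
      Metric.isOpen_ball hball hχ hχc
      (fun t ht => Metric.ball_subset_ball (by linarith) (hχV ht).1)
    have hχ0 : χ 0 = 0 := image_eq_zero_of_notMem_tsupport fun h => lt_irrefl _ (hχV h).2.1
    have hχT : χ T = 0 := image_eq_zero_of_notMem_tsupport fun h => lt_irrefl _ (hχV h).2.2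
    have h1 := hasDerivAt_energy_of_fixed hT hε hg hflow hΦ fun s _ =>
      ⟨by rw [hzero s 0 hχ0, hΦ0], by rw [hzero s T hχT, hΦ0]⟩
    have h2 := hcrit Φ ε hε hΦ (fun t _ => by rw [hΦ0]) fun s _ =>
      ⟨hzero s 0 hχ0, hzero s T hχT⟩
    have h3 := h1.unique h2
    rw [neg_eq_zero, intervalIntegral.integral_congr (g := fun t => χ t * F t) (fun t ht => by
      rw [uIcc_of_le hT.le] at ht
      exact hP t ht), intervalIntegral.integral_of_le hT.le] at h3
    rw [← h3]
    refine (MeasureTheory.setIntegral_eq_integral_of_forall_compl_eq_zero fun t ht => ?_).symm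
    have : χ t = 0 := image_eq_zero_of_notMem_tsupport fun h =>
      ht (Ioo_subset_Ioc_self (hχV h).2)
    rw [this, zero_smul]
  have hVzero : EqOn F (fun _ => 0) V :=
    MeasureTheory.Measure.eqOn_open_of_ae_eq
      ((MeasureTheory.ae_restrict_iff' hVo.measurableSet).2 hae) hVo (hcont.mono hVsub)
      continuousOn_const
  -- This covers `t₀ = 0` and `t₀ = T`, which are not in `V`.
  have hmem : t₀ ∈ closure V := by
    refine Metric.isOpen_ball.inter_closure ⟨Metric.mem_ball_self (by positivity), ?_⟩
    rw [closure_Ioo hT.ne]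
    exact ht₀
  have : (nhdsWithin t₀ V).NeBot := mem_closure_iff_nhdsWithin_neBot.1 hmem
  have hlim : Filter.Tendsto F (nhdsWithin t₀ V) (nhds (F t₀)) :=
    (hcont t₀ ⟨ht₀, Metric.mem_ball_self (by positivity)⟩).mono hVsub
  have hlim0 : Filter.Tendsto F (nhdsWithin t₀ V) (nhds 0) :=
    tendsto_const_nhds.congr' (by
      filter_upwards [self_mem_nhdsWithin] with t ht
      exact (hVzero ht).symm)
  exact tendsto_nhds_unique hlim hlim0

/-- Taking for `ξ` the coordinates of the Euler-Lagrange vector itself gives norm zero,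
contradicting positivity if the vector is nonzero. -/
theorem eulerLagrange_eq_zero (hT : 0 < T)
    (hg : IsMetricFamilyOfClass 3 (Icc 0 T) g) (hflow : IsRicciFlow α (Icc 0 T) g)
    (hφ : ContMDiffOn 𝓘(ℝ, ℝ) (𝓡 n) ∞ φ (Icc 0 T))
    (hcrit : IsCriticalCurve n T (energy T g (fun _ _ => 0)) φ) {t : ℝ} (ht : t ∈ Icc 0 T) :
    eulerLagrange α (Icc 0 T) g φ t = 0 := by
  have hs := mem_extChartAt_source (I := 𝓡 n) (φ t)
  by_contra hne
  refine ((g t).pos (φ t) _ hne).ne' ?_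
  rw [inner_eq_chartMetric (g t) hs]
  exact eulerLagrangeComponent_eq_zero hT hg hflow hφ hcrit ht _

theorem isCriticalCurve_of_eulerLagrange (hT : 0 < T)
    (hg : IsMetricFamilyOfClass 3 (Icc 0 T) g) (hflow : IsRicciFlow α (Icc 0 T) g)
    (h : ∀ t ∈ Icc 0 T, eulerLagrange α (Icc 0 T) g φ t = 0) :
    IsCriticalCurve n T (energy T g (fun _ _ => 0)) φ := by
  classical
  intro Φ ε hε hΦ hΦ0 hfix
  -- A variation agrees with `φ` at `s = 0` only on `[0, T]`. Resetting it to `φ` at other times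
  -- gives `Ψ 0 = φ` as functions, so the hypothesis on `φ` can be rewritten; the energy does not
  -- see the change.
  set Ψ : ℝ → ℝ → M := fun s t => if t ∈ Icc 0 T then Φ s t else φ t with hΨ
  have hΨΦ : ∀ s, ∀ t ∈ Icc 0 T, Ψ s t = Φ s t := fun s t ht => if_pos ht
  have hΨ0 : Ψ 0 = φ := by
    funext t
    by_cases ht : t ∈ Icc 0 T
    · rw [hΨΦ 0 t ht, hΦ0 t ht]
    · exact if_neg ht
  have hsm : ContMDiffOn 𝓘(ℝ, ℝ × ℝ) (𝓡 n) ∞ (fun q : ℝ × ℝ => Ψ q.1 q.2)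
      (Ioo (-ε) ε ×ˢ Icc 0 T) := hΦ.congr fun q hq => hΨΦ q.1 q.2 hq.2
  have h0 : (0 : ℝ) ∈ Icc 0 T := ⟨le_rfl, hT.le⟩
  have hT' : T ∈ Icc 0 T := ⟨hT.le, le_rfl⟩
  have hd := hasDerivAt_energy_of_fixed hT hε hg hflow hsm fun s hs =>
    ⟨by rw [hΨΦ s 0 h0, hΨ0, (hfix s hs).1], by rw [hΨΦ s T hT', hΨ0, (hfix s hs).2]⟩
  have hint : ∫ t in (0 : ℝ)..T, (g t).inner (Ψ 0 t) (eulerLagrange α (Icc 0 T) g (Ψ 0) t)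
      (velocity (Ioo (-ε) ε) (fun s => Ψ s t) 0) = 0 := by
    rw [intervalIntegral.integral_congr (g := fun _ => (0 : ℝ)) fun t ht => ?_]
    · simp
    · rw [uIcc_of_le hT.le] at ht
      have hEL : eulerLagrange α (Icc 0 T) g (Ψ 0) t = 0 := by
        rw [hΨ0]
        exact h t ht
      simp only [hEL, map_zero, zero_apply]
  rw [hint, neg_zero] at hd
  refine hd.congr_of_eventuallyEq (Filter.Eventually.of_forall fun s => ?_)
  exact energy_congr hT.le fun t ht => (hΨΦ s t ht).symm

end Criticality

end OnsagerMachlup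

end

theorem mainTheorem4 {n : ℕ} {M : Type*} [TopologicalSpace M] [T2Space M]
    [ChartedSpace (EuclideanSpace ℝ (Fin n)) M] [IsManifold (𝓡 n) ∞ M]
    (T : ℝ) (hT : 0 < T) (α : ℝ)
    (g : ℝ → Bundle.RiemannianMetric (fun x : M => TangentSpace (𝓡 n) x))
    (hg : OnsagerMachlup.IsMetricFamilyOfClass 3 (Icc 0 T) g)
    (hflow : OnsagerMachlup.IsRicciFlow α (Icc 0 T) g)
    (φ : ℝ → M) (hφ : ContMDiffOn 𝓘(ℝ, ℝ) (𝓡 n) ∞ φ (Icc 0 T)) :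
    OnsagerMachlup.IsCriticalCurve n T (OnsagerMachlup.energy T g (fun _ _ => 0)) φ ↔
      ∀ t ∈ Icc 0 T,
        OnsagerMachlup.covDerivAlong (g t) (Icc 0 T) φ
            (OnsagerMachlup.velocity (Icc 0 T) φ) t
          + α • OnsagerMachlup.sharp (g t) (φ t) (OnsagerMachlup.ricci (g t) (φ t))
              (OnsagerMachlup.velocity (Icc 0 T) φ t)
          + ((1 - 3 * α) / 12) •
              OnsagerMachlup.gradient (g t) (OnsagerMachlup.scalarCurvature (g t)) (φ t) = 0 := by
  exact ⟨fun h t ht => OnsagerMachlup.eulerLagrange_eq_zero hT hg hflow hφ h ht,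
    fun h => OnsagerMachlup.isCriticalCurve_of_eulerLagrange hT hg hflow h⟩
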